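/- Let $N\ge 1$ be an integer, $R>0$, $p>1$, $\mu\ge 0$ and $\nu\in\mathbb R$ with $\delta:=(\mu-1)^2-4\nu^2\ge 0$. Let $f\in H^1(\mathbb R^N)$ and $g\in L^2(\mathbb R^N)$ be non-negative, vanishing almost everywhere outside the ball $\{|x|\le R\}$, and such that the function $\frac{\mu-1-\sqrt\delta}{2}f+g$ is non-negative almost everywhere and not almost everywhere zero (in particular $f$ and $g$ do not both vanish). For $n\geq 1$ let $p_G(n)=1+\frac{2}{n-1}$, with $p_G(1)=+\infty$. For $\varepsilon>0$ consider the Cauchy problem $$u_{tt}-\Delta u+\frac{\mu}{1+t}u_t+\frac{\nu^2}{(1+t)^2}u=|u_t|^p\quad\text{in }\mathbb R^N\times[0,\infty),\qquad u(x,0)=\varepsilon f(x),\quad u_t(x,0)=\varepsilon g(x).\tag{P}$$ For $T\in[0,\infty]$, an energy solution of (P) on $[0,T)$ is a function $u\in C([0,T),H^1(\mathbb R^N))\cap C^1([0,T),L^2(\mathbb R^N))$ with $u_t\in L^p_{loc}((0,T)\times\mathbb R^N)$ which takes the initial data of (P) and satisfies, for all $\Phi\in C_0^\infty(\mathbb R^N\times[0,T))$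 and all $t\in[0,T)$, with $|u_t|^p\Phi$ integrable on $\mathbb R^N\times(0,t)$, $$\int_{\mathbb R^N}u_t(x,t)\Phi(x,t)\,dx-\int_{\mathbb R^N}u_t(x,0)\Phi(x,0)\,dx-\int_0^t\!\!\int_{\mathbb R^N}u_t\Phi_t\,dx\,ds+\int_0^t\!\!\int_{\mathbb R^N}\nabla u\cdot\nabla\Phi\,dx\,ds+\int_0^t\!\!\int_{\mathbb R^N}\frac{\mu}{1+s}u_t\Phi\,dx\,ds+\int_0^t\!\!\int_{\mathbb R^N}\frac{\nu^2}{(1+s)^2}u\,\Phi\,dx\,ds=\int_0^t\!\!\int_{\mathbb R^N}|u_t|^p\Phi\,dx\,ds.$$ Then there are constants $\varepsilon_0>0$ and $C>0$, depending only on $f,g,N,R,p,\mu,\nu$, such that for every $0<\varepsilon\le\varepsilon_0$, every $T_\varepsilon\in[0,\infty]$ and every energy solution $u$ of (P) on $[0,T_\varepsilon)$ with $\operatorname{supp}u\subset\{(x,t):|x|\le t+R\}$, $$T_\varepsilon\le C\,\varepsilon^{-\frac{2(p-1)}{2-(N+\mu-1)(p-1)}}\quad\text{if }1<p<p_G(N+\mu),\qquad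 T_\varepsilon\le\exp\!\left(C\,\varepsilon^{-(p-1)}\right)\quad\text{if }p=p_G(N+\mu).$$ In particular, no such solution is global in time for $1<p\le p_G(N+\mu)$ and $0<\varepsilon\le\varepsilon_0$. -/

import Mathlib

open MeasureTheory
open scoped ENNReal ContDiff

namespace DampedWave

/-- The Euclidean space `ℝ^N`. -/
abbrev Space (N : ℕ) : Type := EuclideanSpace ℝ (Fin N)

/-- The Hilbert space `L²(ℝ^N)` of real-valued functions. -/
abbrev L2 (N : ℕ) : Type := Lp ℝ 2 (volume : Measure (Space N))

/-- The Hilbert space `L²(ℝ^N; ℝ^N)` of vector fields. -/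
abbrev L2Field (N : ℕ) : Type := Lp (Space N) 2 (volume : Measure (Space N))

/-- `δ = (μ - 1)² - 4 ν²`. -/
def delta (μ ν : ℝ) : ℝ := (μ - 1) ^ 2 - 4 * ν ^ 2

/-- The Glassey exponent `p_G(n) = 1 + 2 / (n - 1)` of a real dimension `n ≥ 1`, with
`p_G(1) = +∞`. -/
noncomputable def glasseyExponent (n : ℝ) : EReal :=
  if n ≤ 1 then ⊤ else ((1 + 2 / (n - 1) : ℝ) : EReal)

/-- `G` is the weak (distributional) gradient of `w` on `ℝ^N`:
`∫ w ∇φ = - ∫ φ G` for every test function `φ`. It is used for square integrable `w` and `G`,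
for which both integrals converge. -/
def HasWeakGradient {N : ℕ} (w : Space N → ℝ) (G : Space N → Space N) : Prop :=
  ∀ φ : Space N → ℝ, ContDiff ℝ ∞ φ → HasCompactSupport φ →
    ∫ x, w x • gradient φ x = - ∫ x, φ x • G x

/-- Membership in the Sobolev space `H¹(ℝ^N)`. -/
def MemH1 {N : ℕ} (w : Space N → ℝ) : Prop :=
  MemLp w 2 volume ∧ ∃ G : Space N → Space N, MemLp G 2 volume ∧ HasWeakGradient w G

/-- The time interval `[0, T)`, where `T = ∞` is allowed. -/
def timeInterval (T : ℝ≥0∞) : Set ℝ := {t | 0 ≤ t ∧ ENNReal.ofReal t < T}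

/-- The test functions `C₀^∞(ℝ^N × [0, T))`, written as functions of `(t, x)`: smooth up to and
including `t = 0`, with compact support contained in `t < T`. -/
def IsTestFunction {N : ℕ} (T : ℝ≥0∞) (Φ : ℝ × Space N → ℝ) : Prop :=
  ContDiff ℝ ∞ Φ ∧ HasCompactSupport Φ ∧ ∀ z ∈ tsupport Φ, ENNReal.ofReal z.1 < T

/-- The weak form of `u_tt - Δu + μ/(1+t) u_t + ν²/(1+t)² u = |u_t|^p`, tested with `Φ` on the
time interval `[0, t]`; `ut` is the time derivative and `Du` the spatial gradient of `u`. -/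
def WeakIdentity {N : ℕ} (μ ν p : ℝ) (u ut : ℝ → L2 N) (Du : ℝ → L2Field N)
    (Φ : ℝ × Space N → ℝ) (t : ℝ) : Prop :=
  (∫ x, ut t x * Φ (t, x)) - (∫ x, ut 0 x * Φ (0, x))
      - (∫ s in (0 : ℝ)..t, ∫ x, ut s x * deriv (fun τ => Φ (τ, x)) s)
      + (∫ s in (0 : ℝ)..t, ∫ x, inner ℝ (Du s x) (gradient (fun y => Φ (s, y)) x))
      + (∫ s in (0 : ℝ)..t, ∫ x, μ / (1 + s) * ut s x * Φ (s, x))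
      + (∫ s in (0 : ℝ)..t, ∫ x, ν ^ 2 / (1 + s) ^ 2 * u s x * Φ (s, x))
    = ∫ s in (0 : ℝ)..t, ∫ x, |ut s x| ^ p * Φ (s, x)

/-- `u` is an energy solution on `[0, T)` of the Cauchy problem
`u_tt - Δu + μ/(1+t) u_t + ν²/(1+t)² u = |u_t|^p`, `u(0) = ε f`, `u_t(0) = ε g`, with time
derivative `ut`, spatial gradient `Du`, and with `v`, a function on space-time, as a jointly
measurable representative of the time derivative. -/
structure IsEnergySolutionWith {N : ℕ} (μ ν p ε : ℝ) (f g : Space N → ℝ) (T : ℝ≥0∞)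
    (u ut : ℝ → L2 N) (Du : ℝ → L2Field N) (v : ℝ × Space N → ℝ) : Prop where
  /-- `u ∈ C([0, T), H¹)`: `u` and its weak gradient are continuous in time with values in `L²`. -/
  continuousOn : ContinuousOn u (timeInterval T)
  hasWeakGradient : ∀ t ∈ timeInterval T, HasWeakGradient (u t) (Du t)
  continuousOn_grad : ContinuousOn Du (timeInterval T)
  /-- `u ∈ C¹([0, T), L²)`, with derivative `ut`. -/
  hasDerivWithinAt : ∀ t ∈ timeInterval T, HasDerivWithinAt u (ut t) (timeInterval T) t
  continuousOn_deriv : ContinuousOn ut (timeInterval T)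
  /-- The initial data. -/
  initial : ∀ᵐ x, u 0 x = ε * f x
  initial_deriv : ∀ᵐ x, ut 0 x = ε * g x
  /-- `v` represents `u_t` on space-time. -/
  representative : ∀ᵐ s, s ∈ timeInterval T → ∀ᵐ x, v (s, x) = ut s x
  /-- `u_t ∈ L^p_loc((0, T) × ℝ^N)`. -/
  memLp_loc : ∀ K : Set (ℝ × Space N), IsCompact K →
    (∀ z ∈ K, 0 < z.1 ∧ ENNReal.ofReal z.1 < T) →
      MemLp v (ENNReal.ofReal p) (volume.restrict K)
  /-- The nonlinear term of the weak form is an absolutely convergent integral. -/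
  integrableOn_nonlinearity : ∀ Φ : ℝ × Space N → ℝ, IsTestFunction T Φ →
    ∀ t ∈ timeInterval T,
      IntegrableOn (fun z => |v z| ^ p * Φ z) (Set.Ioc 0 t ×ˢ Set.univ) volume
  /-- The weak form of the equation. -/
  weakIdentity : ∀ Φ : ℝ × Space N → ℝ, IsTestFunction T Φ →
    ∀ t ∈ timeInterval T, WeakIdentity μ ν p u ut Du Φ t

/-- `u` is an energy solution on `[0, T)` of
`u_tt - Δu + μ/(1+t) u_t + ν²/(1+t)² u = |u_t|^p`, `u(0) = ε f`, `u_t(0) = ε g`. -/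
def IsEnergySolution {N : ℕ} (μ ν p ε : ℝ) (f g : Space N → ℝ) (T : ℝ≥0∞)
    (u : ℝ → L2 N) : Prop :=
  ∃ (ut : ℝ → L2 N) (Du : ℝ → L2Field N) (v : ℝ × Space N → ℝ),
    IsEnergySolutionWith μ ν p ε f g T u ut Du v

/-- The support of `u` in `[0, T) × ℝ^N` is contained in the cone `|x| ≤ t + R`. -/
def SupportedInCone {N : ℕ} (R : ℝ) (T : ℝ≥0∞) (u : ℝ → L2 N) : Prop :=
  ∀ t ∈ timeInterval T, ∀ᵐ x, t + R < ‖x‖ → u t x = 0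

end DampedWave

open DampedWave

open Set

namespace DampedWave

/-! The function φ(x) = e^{xᵢ} satisfies Δφ = φ. Hence U(t) = ∫ u φ, with D = U' = ∫ u_t φ, obeys
U'' + μ/(1+t) U' + ν²/(1+t)² U = U + ∫ |u_t|^p φ. The cone condition confines these integrals to a
ball of radius t + R + 1, on which φ has integral O(e^t (1+t)^{(N-1)/2}). Hölder's inequality then
bounds the source below by σ, a multiple of (e^t (1+t)^{(N-1)/2})^{-(p-1)} |D|^p
(`IsEnergySolutionWith.isSupersolution`). What remains is a scalar differential inequality.

Since δ ≥ 0, the damped operator factors into real first-order operators. This gives U ≥ 0 and, at a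
time fixed by μ and ν, D ≥ const·ε (`IsSupersolution.nonneg`, `IsSupersolution.le_deriv`). Solutions
of the linear equation behave like e^{±t} (1+t)^{-μ/2}. With m ≈ e^{-t} (1+t)^{μ/2}, the quantity
m(D + U) therefore stays, up to lower-order corrections, above F = const·ε + ∫ mσ. A second
comparison isolates the derivative: mD ≥ F/4 (`IsSupersolution.weight_integral_le_deriv`).

Inserted into F' = mσ, this makes the exponentials cancel and leaves F' ≥ k (1+t)^{-θ} F^p with θ =
(N+μ-1)(p-1)/2. Integration gives ∫ (1+s)^{-θ} ds ≤ B ε^{-(p-1)} up to the lifespan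
(`primitive_bound_of_powerSource`). The integral grows like a power of T if θ < 1 and like log T if
θ = 1, which are the cases p < p_G(N+μ) and p = p_G(N+μ). -/

/-! ### Second-order differential inequalities in integrated form -/

/-- Multiplying an integral differential inequality by a non-negative monotone weight. -/
theorem integral_weight_le_sub {r t : ℝ} (hrt : r ≤ t) {D q η η' : ℝ → ℝ}
    (hD : ContinuousOn D (Icc r t)) (hq : ContinuousOn q (Icc r t))
    (hineq : ∀ x y, r ≤ x → x ≤ y → y ≤ t → ∫ s in x..y, q s ≤ D y - D x)
    (hη : ∀ s ∈ Icc r t, HasDerivAt η (η' s) s) (hη' : ContinuousOn η' (Icc r t))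
    (hη0 : ∀ s ∈ Icc r t, 0 ≤ η s)
    (hmono : (∀ s ∈ Icc r t, 0 ≤ η' s) ∨ (∀ s ∈ Icc r t, η' s ≤ 0)) :
    ∫ s in r..t, (η' s * D s + η s * q s) ≤ η t * D t - η r * D r := by
  have hηc : ContinuousOn η (Icc r t) := fun s hs => (hη s hs).continuousAt.continuousWithinAt
  have hu : uIcc r t = Icc r t := uIcc_of_le hrt
  have hqi : IntervalIntegrable q volume r t := (hu ▸ hq).intervalIntegrable
  set H : ℝ → ℝ := fun s => ∫ τ in r..s, q τ with hHdef
  have hHc : ContinuousOn H (Icc r t) := by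
    have := intervalIntegral.continuousOn_primitive_interval' hqi (left_mem_uIcc)
    rwa [hu] at this
  have hqsub : ∀ x y, r ≤ x → x ≤ y → y ≤ t → IntervalIntegrable q volume x y := by
    intro x y h1 h2 h3
    apply ContinuousOn.intervalIntegrable
    rw [uIcc_of_le h2]
    exact hq.mono (Icc_subset_Icc h1 h3)
  have hHd : ∀ s ∈ Ioo r t, HasDerivAt H (q s) s := by
    intro s hs
    have hnhds : Icc r t ∈ nhds s := Icc_mem_nhds hs.1 hs.2
    refine intervalIntegral.integral_hasDerivAt_right (hqsub r s le_rfl hs.1.le hs.2.le) ?_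
      (hq.continuousAt hnhds)
    exact hq.stronglyMeasurableAtFilter_nhdsWithin measurableSet_Icc s |>.filter_mono (by
      rw [nhdsWithin_eq_nhds.2 hnhds])
  have hG : ∀ x y, r ≤ x → x ≤ y → y ≤ t → D x - H x ≤ D y - H y := by
    intro x y h1 h2 h3
    have e : H y - H x = ∫ s in x..y, q s :=
      intervalIntegral.integral_interval_sub_left (hqsub r y le_rfl (h1.trans h2) h3)
        (hqsub r x le_rfl h1 (h2.trans h3))
    have := hineq x y h1 h2 h3
    linarith
  have hi : ∀ {k : ℝ → ℝ}, ContinuousOn k (Icc r t) → IntervalIntegrable k volume r t :=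
    fun hk => (hu.symm ▸ hk : ContinuousOn _ (uIcc r t)).intervalIntegrable
  have e1 : ∫ s in r..t, (η' s * H s + η s * q s) = η t * H t - η r * H r := by
    apply intervalIntegral.integral_eq_sub_of_hasDerivAt_of_le hrt (f := fun s => η s * H s)
      (hηc.mul hHc)
    · intro s hs
      exact (hη s (Ioo_subset_Icc_self hs)).mul (hHd s hs)
    · exact hi ((hη'.mul hHc).add (hηc.mul hq))
  have e2 : ∫ s in r..t, η' s = η t - η r :=
    intervalIntegral.integral_eq_sub_of_hasDerivAt_of_le hrt hηc
      (fun s hs => hη s (Ioo_subset_Icc_self hs)) (hi hη')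
  have e3 : ∫ s in r..t, (η' s * D s + η s * q s) =
      (∫ s in r..t, (η' s * H s + η s * q s)) + ∫ s in r..t, η' s * (D s - H s) := by
    have i1 : IntervalIntegrable (fun s => η' s * H s + η s * q s) volume r t :=
      hi ((hη'.mul hHc).add (hηc.mul hq))
    have i2 : IntervalIntegrable (fun s => η' s * (D s - H s)) volume r t :=
      hi (hη'.mul (hD.sub hHc))
    rw [← intervalIntegral.integral_add i1 i2]
    congr 1
    ext s
    ring
  have hH0 : H r = 0 := intervalIntegral.integral_same
  have hGrt := hG r t le_rfl hrt le_rfl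
  -- `D` is only continuous, so a product rule for `η * (D - H)` is unavailable. But `D - H` is
  -- non-decreasing, and it may be replaced by its value at `t` if `η' ≥ 0`, at `r` if `η' ≤ 0`; `η
  -- ≥ 0` at the other endpoint closes the estimate.
  have e4 : ∫ s in r..t, η' s * (D s - H s) ≤ η t * (D t - H t) - η r * (D r - H r) := by
    rcases hmono with h | h
    · have : ∫ s in r..t, η' s * (D s - H s) ≤ ∫ s in r..t, η' s * (D t - H t) := by
        apply intervalIntegral.integral_mono_on hrt (hi (hη'.mul (hD.sub hHc)))
          (hi (hη'.mul continuousOn_const))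
        intro s hs
        exact mul_le_mul_of_nonneg_left (hG s t hs.1 hs.2 le_rfl) (h s hs)
      rw [intervalIntegral.integral_mul_const, e2] at this
      nlinarith [hη0 r (left_mem_Icc.2 hrt)]
    · have : ∫ s in r..t, η' s * (D s - H s) ≤ ∫ s in r..t, η' s * (D r - H r) := by
        apply intervalIntegral.integral_mono_on hrt (hi (hη'.mul (hD.sub hHc)))
          (hi (hη'.mul continuousOn_const))
        intro s hs
        exact mul_le_mul_of_nonpos_left (hG r s le_rfl hs.1 hs.2) (h s hs)
      rw [intervalIntegral.integral_mul_const, e2] at this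
      nlinarith [hη0 t (right_mem_Icc.2 hrt)]
  rw [e3, e1]
  linarith

/-- `U` is of class `C¹` on `[0, T]` with derivative `D`, and
`D' + μ/(1+t) D + ν²/(1+t)² U ≥ U + σ` holds in integrated form, with a source `σ ≥ 0`. -/
structure IsSupersolution (μ ν T : ℝ) (σ U D : ℝ → ℝ) : Prop where
  hasDerivWithinAt : ∀ t ∈ Icc 0 T, HasDerivWithinAt U (D t) (Icc 0 T) t
  continuousOn_deriv : ContinuousOn D (Icc 0 T)
  continuousOn_source : ContinuousOn σ (Icc 0 T)
  source_nonneg : ∀ t ∈ Icc 0 T, 0 ≤ σ t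
  integral_le : ∀ r t, 0 ≤ r → r ≤ t → t ≤ T →
    ∫ s in r..t, (-(μ / (1 + s)) * D s + (1 - ν ^ 2 / (1 + s) ^ 2) * U s + σ s) ≤ D t - D r

namespace IsSupersolution

variable {μ ν T : ℝ} {σ U D : ℝ → ℝ}

theorem continuousOn (h : IsSupersolution μ ν T σ U D) : ContinuousOn U (Icc 0 T) :=
  fun t ht => (h.hasDerivWithinAt t ht).continuousWithinAt

theorem hasDerivAt (h : IsSupersolution μ ν T σ U D) {t : ℝ} (ht : t ∈ Ioo 0 T) :
    HasDerivAt U (D t) t :=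
  (h.hasDerivWithinAt t (Ioo_subset_Icc_self ht)).hasDerivAt (Icc_mem_nhds ht.1 ht.2)

/-- Testing the differential inequality with the weights `η` and `ζ`. -/
theorem integral_le_of_weights (h : IsSupersolution μ ν T σ U D) {r t : ℝ} (hr : 0 ≤ r)
    (hrt : r ≤ t) (htT : t ≤ T) {η η' ζ ζ' q : ℝ → ℝ}
    (hη : ∀ s ∈ Icc r t, HasDerivAt η (η' s) s) (hη' : ContinuousOn η' (Icc r t))
    (hη0 : ∀ s ∈ Icc r t, 0 ≤ η s)
    (hmono : (∀ s ∈ Icc r t, 0 ≤ η' s) ∨ (∀ s ∈ Icc r t, η' s ≤ 0))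
    (hζ : ∀ s ∈ Icc r t, HasDerivAt ζ (ζ' s) s) (hζ' : ContinuousOn ζ' (Icc r t))
    (hq : ContinuousOn q (Icc r t))
    (hle : ∀ s ∈ Icc r t, q s ≤ (η' s - η s * (μ / (1 + s)) + ζ s) * D s
      + (η s * (1 - ν ^ 2 / (1 + s) ^ 2) + ζ' s) * U s + η s * σ s) :
    ∫ s in r..t, q s ≤ (η t * D t + ζ t * U t) - (η r * D r + ζ r * U r) := by
  have hsub : Icc r t ⊆ Icc 0 T := Icc_subset_Icc hr htT
  have hD := h.continuousOn_deriv.mono hsub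
  have hU := h.continuousOn.mono hsub
  have hσ := h.continuousOn_source.mono hsub
  have hηc : ContinuousOn η (Icc r t) := fun s hs => (hη s hs).continuousAt.continuousWithinAt
  have hζc : ContinuousOn ζ (Icc r t) := fun s hs => (hζ s hs).continuousAt.continuousWithinAt
  have hi : ∀ {k : ℝ → ℝ}, ContinuousOn k (Icc r t) → IntervalIntegrable k volume r t :=
    fun hk => ((uIcc_of_le hrt).symm ▸ hk : ContinuousOn _ (uIcc r t)).intervalIntegrable
  have hpos : ∀ s ∈ Icc r t, (1 + s) ≠ 0 := fun s hs => by linarith [hs.1]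
  have hq' : ContinuousOn (fun s => -(μ / (1 + s)) * D s + (1 - ν ^ 2 / (1 + s) ^ 2) * U s + σ s)
      (Icc r t) := by
    refine (ContinuousOn.add (ContinuousOn.mul ?_ hD) (ContinuousOn.mul ?_ hU)).add hσ
    · exact (continuousOn_const.div (by fun_prop) hpos).neg
    · exact continuousOn_const.sub
        (continuousOn_const.div (by fun_prop) fun s hs => pow_ne_zero 2 (hpos s hs))
  have h1 := integral_weight_le_sub hrt hD hq'
    (fun x y h1 h2 h3 => h.integral_le x y (hr.trans h1) h2 (h3.trans htT)) hη hη' hη0 hmono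
  have h2 : ∫ s in r..t, (ζ' s * U s + ζ s * D s) = ζ t * U t - ζ r * U r := by
    apply intervalIntegral.integral_eq_sub_of_hasDerivAt_of_le hrt (f := fun s => ζ s * U s)
      (hζc.mul hU)
    · intro s hs
      exact (hζ s (Ioo_subset_Icc_self hs)).mul
        (h.hasDerivAt ⟨hr.trans_lt hs.1, hs.2.trans_le htT⟩)
    · exact hi ((hζ'.mul hU).add (hζc.mul hD))
  have h3 : ∫ s in r..t, q s ≤ (∫ s in r..t, (η' s * D s + η s *
      (-(μ / (1 + s)) * D s + (1 - ν ^ 2 / (1 + s) ^ 2) * U s + σ s)))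
      + ∫ s in r..t, (ζ' s * U s + ζ s * D s) := by
    have i1 : IntervalIntegrable (fun s => η' s * D s + η s *
        (-(μ / (1 + s)) * D s + (1 - ν ^ 2 / (1 + s) ^ 2) * U s + σ s)) volume r t :=
      hi ((hη'.mul hD).add (hηc.mul hq'))
    have i2 : IntervalIntegrable (fun s => ζ' s * U s + ζ s * D s) volume r t :=
      hi ((hζ'.mul hU).add (hζc.mul hD))
    rw [← intervalIntegral.integral_add i1 i2]
    apply intervalIntegral.integral_mono_on hrt (hi hq) (i1.add i2)
    intro s hs
    refine (hle s hs).trans (le_of_eq ?_)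
    ring
  linarith

end IsSupersolution

/-! ### Exponential-polynomial weights -/

/-- The weight `(1 + s)^a e^{ls} e^{-c/(1+s)}`. -/
noncomputable def weight (a l c s : ℝ) : ℝ := Real.exp (l * s + a * Real.log (1 + s) - c / (1 + s))

theorem weight_pos (a l c s : ℝ) : 0 < weight a l c s := Real.exp_pos _

theorem hasDerivAt_weight (a l c : ℝ) {s : ℝ} (hs : 0 ≤ s) :
    HasDerivAt (weight a l c) (weight a l c s * (l + a / (1 + s) + c / (1 + s) ^ 2)) s := by
  have h1 : (1 + s) ≠ 0 := by linarith
  have hd : HasDerivAt (fun s : ℝ => 1 + s) 1 s := (hasDerivAt_id s).const_add 1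
  have := (((hasDerivAt_id s).const_mul l).add ((hd.log h1).const_mul a)).sub
    ((hasDerivAt_const s c).div hd h1)
  refine (this.exp).congr_deriv ?_
  simp only [weight]
  congr 1
  field_simp
  ring

theorem continuousOn_weight (a l c : ℝ) {r t : ℝ} (hr : 0 ≤ r) :
    ContinuousOn (weight a l c) (Icc r t) := fun _ hs =>
  (hasDerivAt_weight a l c (hr.trans hs.1)).continuousAt.continuousWithinAt

theorem continuousOn_deriv_weight (a l c : ℝ) {r t : ℝ} (hr : 0 ≤ r) :
    ContinuousOn (fun s => weight a l c s * (l + a / (1 + s) + c / (1 + s) ^ 2)) (Icc r t) := by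
  have hpos : ∀ s ∈ Icc r t, (1 + s) ≠ 0 := fun s hs => by linarith [hs.1]
  refine (continuousOn_weight a l c hr).mul ((continuousOn_const.add ?_).add ?_)
  · exact continuousOn_const.div (by fun_prop) hpos
  · exact continuousOn_const.div (by fun_prop) fun s hs => pow_ne_zero 2 (hpos s hs)

/-- Together with a + b = μ, this is the matching of coefficients that factors the damped operator;
δ ≥ 0 keeps the roots real. -/
theorem delta_eq_mul (μ ν : ℝ) (hδ : 0 ≤ delta μ ν) :
    ((μ + 1 + √(delta μ ν)) / 2 - 1) * ((μ - 1 - √(delta μ ν)) / 2) = ν ^ 2 := by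
  have := Real.sq_sqrt hδ
  have h2 : delta μ ν = (μ - 1) ^ 2 - 4 * ν ^ 2 := rfl
  nlinarith

/-! ### Positivity, and a lower bound for the derivative at a fixed time -/

namespace IsSupersolution

variable {μ ν T : ℝ} {σ U D : ℝ → ℝ}

/-- The product rule gives ((1+s)^b U)' = (1+s)^b (D + b/(1+s) U), which is the inner factor of the
operator; the mean value inequality does the rest. -/
theorem weight_mul_monotone_aux (h : IsSupersolution μ ν T σ U D) {b r t : ℝ} (hr : 0 ≤ r)
    (hrt : r ≤ t) (htT : t ≤ T) {k : ℝ}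
    (hk : ∀ s ∈ Icc r t, k ≤ weight b 0 0 s * (D s + b / (1 + s) * U s)) :
    k * (t - r) ≤ weight b 0 0 t * U t - weight b 0 0 r * U r := by
  have hsub : Icc r t ⊆ Icc 0 T := Icc_subset_Icc hr htT
  have hder : ∀ s ∈ Ioo r t, HasDerivAt (fun s => weight b 0 0 s * U s)
      (weight b 0 0 s * (D s + b / (1 + s) * U s)) s := by
    intro s hs
    refine ((hasDerivAt_weight b 0 0 (hr.trans hs.1.le)).mul
      (h.hasDerivAt ⟨hr.trans_lt hs.1, hs.2.trans_le htT⟩)).congr_deriv ?_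
    ring
  refine (convex_Icc r t).mul_sub_le_image_sub_of_le_deriv
    ((continuousOn_weight b 0 0 hr).mul (h.continuousOn.mono hsub)) ?_ ?_ r
    (left_mem_Icc.2 hrt) t (right_mem_Icc.2 hrt) hrt
  · rw [interior_Icc]
    exact fun s hs => (hder s hs).differentiableAt.differentiableWithinAt
  · rw [interior_Icc]
    intro s hs
    exact (hk s (Ioo_subset_Icc_self hs)).trans_eq (hder s hs).deriv.symm

/-- With `∂ₜ² + μ/(1+t) ∂ₜ + ν²/(1+t)² = (∂ₜ + a/(1+t))(∂ₜ + b/(1+t))`, the quantity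
`(1+t)^a (D + b/(1+t) U)` does not decrease as long as `U ≥ 0`. -/
theorem factor_le (h : IsSupersolution μ ν T σ U D) (hμ : 0 ≤ μ) (hδ : 0 ≤ delta μ ν)
    {a b : ℝ} (ha : a = (μ + 1 + √(delta μ ν)) / 2) (hb : b = (μ - 1 - √(delta μ ν)) / 2)
    {t : ℝ} (ht : 0 ≤ t) (htT : t ≤ T) (hU : ∀ s ∈ Icc 0 t, 0 ≤ U s) :
    D 0 + b * U 0 ≤ weight a 0 0 t * (D t + b / (1 + t) * U t) := by
  have hab : (a - 1) * b = ν ^ 2 := by rw [ha, hb]; exact delta_eq_mul μ ν hδ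
  have hab' : a + b = μ := by rw [ha, hb]; ring
  have ha0 : 0 ≤ a := by rw [ha]; positivity
  have hpos : ∀ s ∈ Icc 0 t, 0 < (1 + s) := fun s hs => by linarith [hs.1]
  have key := h.integral_le_of_weights le_rfl ht htT (η := weight a 0 0)
    (η' := fun s => weight a 0 0 s * (0 + a / (1 + s) + 0 / (1 + s) ^ 2))
    (ζ := fun s => weight a 0 0 s * (b / (1 + s)))
    (ζ' := fun s => weight a 0 0 s * (b * (a - 1) / (1 + s) ^ 2)) (q := fun _ => 0)
    (fun s hs => hasDerivAt_weight a 0 0 hs.1) (continuousOn_deriv_weight a 0 0 le_rfl)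
    (fun s _ => (weight_pos _ _ _ _).le)
    (Or.inl fun s hs => mul_nonneg (weight_pos _ _ _ _).le (by
      have := hpos s hs
      positivity))
    (fun s hs => by
      have h1 := (hpos s hs).ne'
      have hd : HasDerivAt (fun s : ℝ => 1 + s) 1 s := (hasDerivAt_id s).const_add 1
      refine ((hasDerivAt_weight a 0 0 hs.1).mul
        ((hasDerivAt_const s b).div hd h1)).congr_deriv ?_
      simp only [Pi.div_apply]
      field_simp
      ring)
    ((continuousOn_weight a 0 0 le_rfl).mul (continuousOn_const.div (by fun_prop)
      fun s hs => pow_ne_zero 2 (hpos s hs).ne'))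
    continuousOn_const
    (fun s hs => by
      have h1 := (hpos s hs).ne'
      have hw := (weight_pos a 0 0 s).le
      have hσ := h.source_nonneg s ⟨hs.1, hs.2.trans htT⟩
      -- The relations a + b = μ and (a-1)b = ν² cancel all terms in `D` and all terms in U/(1+s)²,
      -- leaving only U + σ.
      have e : (weight a 0 0 s * (0 + a / (1 + s) + 0 / (1 + s) ^ 2)
          - weight a 0 0 s * (μ / (1 + s)) + weight a 0 0 s * (b / (1 + s))) * D s
          + (weight a 0 0 s * (1 - ν ^ 2 / (1 + s) ^ 2)
            + weight a 0 0 s * (b * (a - 1) / (1 + s) ^ 2)) * U s + weight a 0 0 s * σ s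
          = weight a 0 0 s * (U s + σ s) := by
        rw [← hab, ← hab']
        field_simp
        ring
      rw [e]
      exact mul_nonneg hw (add_nonneg (hU s hs) hσ))
  have hw0 : weight a 0 0 0 = 1 := by simp [weight]
  simp only [intervalIntegral.integral_zero, hw0] at key
  norm_num at key
  linarith

/-- Positivity of a supersolution with non-negative data. -/
theorem nonneg (h : IsSupersolution μ ν T σ U D) (hμ : 0 ≤ μ) (hδ : 0 ≤ delta μ ν)
    {a b : ℝ} (ha : a = (μ + 1 + √(delta μ ν)) / 2) (hb : b = (μ - 1 - √(delta μ ν)) / 2)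
    (hU0 : 0 ≤ U 0) (hV0 : 0 < D 0 + b * U 0) :
    ∀ t ∈ Icc 0 T, 0 ≤ U t := by
  set V0 := D 0 + b * U 0 with hV0def
  set w : ℝ → ℝ := fun t => weight a 0 0 t * (D t + b / (1 + t) * U t) with hw
  have hpos : ∀ s ∈ Icc 0 T, 0 < (1 + s) := fun s hs => by linarith [hs.1]
  have hwc : ContinuousOn w (Icc 0 T) :=
    (continuousOn_weight a 0 0 le_rfl).mul (h.continuousOn_deriv.add
      ((continuousOn_const.div (by fun_prop) fun s hs => (hpos s hs).ne').mul h.continuousOn))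
  have step : ∀ t ∈ Icc 0 T, (∀ s ∈ Ico 0 t, 0 ≤ w s) → 0 ≤ U t := by
    intro t ht hs
    have hs' : ∀ s ∈ Icc 0 t, 0 ≤ w s := by
      rcases ht.1.eq_or_lt with h0 | h0
      · intro s hs0
        have : s = 0 := by rw [← h0] at hs0; simpa using hs0
        subst this
        simp only [hw]
        have hw0 : weight a 0 0 0 = 1 := by simp [weight]
        rw [hw0]
        simp only [add_zero, div_one, one_mul]
        exact hV0.le
      · have hcl : IsClosed (Icc 0 t ∩ w ⁻¹' Ici 0) :=
          (hwc.mono (Icc_subset_Icc_right ht.2)).preimage_isClosed_of_isClosed isClosed_Icc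
            isClosed_Ici
        have : Icc 0 t ⊆ Icc 0 t ∩ w ⁻¹' Ici 0 := by
          nth_rewrite 1 [← closure_Ico h0.ne]
          exact closure_minimal (fun s hs0 => ⟨Ico_subset_Icc_self hs0, hs s hs0⟩) hcl
        exact fun s hs0 => (this hs0).2
    have := h.weight_mul_monotone_aux (b := b) (r := 0) le_rfl ht.1 ht.2 (k := 0) (fun s hs0 => by
      have h1 := hs' s hs0
      exact mul_nonneg (weight_pos _ _ _ _).le ((mul_nonneg_iff_of_pos_left
        (weight_pos a 0 0 s)).1 h1))
    have h0 := mul_nonneg (weight_pos b 0 0 0).le hU0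
    exact (mul_nonneg_iff_of_pos_left (weight_pos b 0 0 t)).1 (by linarith)
  -- Continuity argument: up to the first time `t₀` with w ≤ 0 the function `U` is non-negative, so
  -- `factor_le` keeps `w t₀` above the positive number `V0`.
  have hwpos : ∀ t ∈ Icc 0 T, 0 < w t := by
    by_contra! hcon
    obtain ⟨t, ht, hwt⟩ := hcon
    set K := Icc 0 T ∩ w ⁻¹' Iic 0 with hK
    have hKc : IsCompact K := isCompact_Icc.of_isClosed_subset
      (hwc.preimage_isClosed_of_isClosed isClosed_Icc isClosed_Iic) inter_subset_left
    obtain ⟨t₀, ht₀, hmin⟩ := hKc.exists_isLeast ⟨t, ht, hwt⟩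
    have hbefore : ∀ s ∈ Ico 0 t₀, 0 ≤ w s := by
      intro s hs
      by_contra! hneg
      exact absurd (hmin ⟨⟨hs.1, hs.2.le.trans ht₀.1.2⟩, hneg.le⟩) (not_le.2 hs.2)
    have hUs : ∀ s ∈ Icc 0 t₀, 0 ≤ U s := fun s hs =>
      step s ⟨hs.1, hs.2.trans ht₀.1.2⟩ fun x hx => hbefore x ⟨hx.1, hx.2.trans_le hs.2⟩
    have := h.factor_le hμ hδ ha hb ht₀.1.1 ht₀.1.2 hUs
    have h3 : w t₀ ≤ 0 := ht₀.2
    simp only [hw] at h3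
    linarith
  exact fun t ht => step t ht fun s hs => (hwpos s ⟨hs.1, hs.2.le.trans ht.2⟩).le

theorem factor_pos (h : IsSupersolution μ ν T σ U D) (hμ : 0 ≤ μ) (hδ : 0 ≤ delta μ ν)
    {b : ℝ} (hb : b = (μ - 1 - √(delta μ ν)) / 2)
    (hU0 : 0 ≤ U 0) (hV0 : 0 < D 0 + b * U 0) {t : ℝ} (ht : t ∈ Icc 0 T) :
    0 < D t + b / (1 + t) * U t := by
  have hU := h.nonneg hμ hδ rfl hb hU0 hV0
  have := h.factor_le hμ hδ rfl hb ht.1 ht.2 (fun s hs => hU s ⟨hs.1, hs.2.trans ht.2⟩)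
  exact (mul_pos_iff_of_pos_left (weight_pos _ 0 0 t)).1 (hV0.trans_le this)

theorem weight_mul_mono (h : IsSupersolution μ ν T σ U D) (hμ : 0 ≤ μ) (hδ : 0 ≤ delta μ ν)
    {b : ℝ} (hb : b = (μ - 1 - √(delta μ ν)) / 2)
    (hU0 : 0 ≤ U 0) (hV0 : 0 < D 0 + b * U 0) {r t : ℝ} (hr : 0 ≤ r) (hrt : r ≤ t) (ht : t ≤ T) :
    weight b 0 0 r * U r ≤ weight b 0 0 t * U t := by
  have := h.weight_mul_monotone_aux (b := b) hr hrt ht (k := 0) (fun s hs =>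
    mul_nonneg (weight_pos _ _ _ _).le
      (h.factor_pos hμ hδ hb hU0 hV0 ⟨hr.trans hs.1, hs.2.trans ht⟩).le)
  linarith

/-- On [0, 1] the derivative of (1+s)^b U is (1+s)^{b-a} times the quantity bounded below by
`factor_le`. Since a - b = 1 + √δ, it is at least 2^{-(1+√δ)} times the data; after time 1 the
monotonicity of (1+t)^b U preserves the gain. -/
theorem le_weight_mul (h : IsSupersolution μ ν T σ U D) (hμ : 0 ≤ μ) (hδ : 0 ≤ delta μ ν)
    {b : ℝ} (hb : b = (μ - 1 - √(delta μ ν)) / 2)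
    (hU0 : 0 ≤ U 0) (hV0 : 0 < D 0 + b * U 0) {t : ℝ} (ht1 : 1 ≤ t) (ht : t ≤ T) :
    Real.exp (-(1 + √(delta μ ν)) * Real.log 2) * (D 0 + b * U 0) ≤ weight b 0 0 t * U t := by
  have hU := h.nonneg hμ hδ rfl hb hU0 hV0
  have h1 := h.weight_mul_monotone_aux (b := b) le_rfl zero_le_one (ht1.trans ht)
    (k := Real.exp (-(1 + √(delta μ ν)) * Real.log 2) * (D 0 + b * U 0)) (fun s hs => by
      have hsT : s ≤ T := hs.2.trans (ht1.trans ht)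
      have h2 := h.factor_le hμ hδ rfl hb hs.1 hsT (fun x hx => hU x ⟨hx.1, hx.2.trans hsT⟩)
      have e : weight b 0 0 s = Real.exp (-(1 + √(delta μ ν)) * Real.log (1 + s)) *
          weight ((μ + 1 + √(delta μ ν)) / 2) 0 0 s := by
        simp only [weight]
        rw [← Real.exp_add]
        congr 1
        rw [hb]
        ring
      have h3 : Real.exp (-(1 + √(delta μ ν)) * Real.log 2) ≤
          Real.exp (-(1 + √(delta μ ν)) * Real.log (1 + s)) := by
        rw [Real.exp_le_exp]
        have : Real.log (1 + s) ≤ Real.log 2 :=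
          Real.log_le_log (by linarith [hs.1]) (by linarith [hs.2])
        nlinarith [Real.sqrt_nonneg (delta μ ν)]
      rw [e, mul_assoc]
      exact mul_le_mul h3 h2 hV0.le (Real.exp_pos _).le)
  have h2 := h.weight_mul_mono hμ hδ hb hU0 hV0 zero_le_one ht1 ht
  have h3 := mul_nonneg (weight_pos b 0 0 0).le hU0
  linarith

/-- For large times the derivative is non-decreasing up to the weight `(1 + t)^μ`. -/
theorem weight_mul_deriv_mono (h : IsSupersolution μ ν T σ U D) (hμ : 0 ≤ μ)
    {r t k : ℝ} (hr : 0 ≤ r) (hrt : r ≤ t) (ht : t ≤ T)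
    (hk : ∀ s ∈ Icc r t, k ≤ weight μ 0 0 s * ((1 - ν ^ 2 / (1 + s) ^ 2) * U s)) :
    weight μ 0 0 r * D r + k * (t - r) ≤ weight μ 0 0 t * D t := by
  have key := h.integral_le_of_weights hr hrt ht (η := weight μ 0 0)
    (η' := fun s => weight μ 0 0 s * (0 + μ / (1 + s) + 0 / (1 + s) ^ 2))
    (ζ := fun _ => 0) (ζ' := fun _ => 0) (q := fun _ => k)
    (fun s hs => hasDerivAt_weight μ 0 0 (hr.trans hs.1)) (continuousOn_deriv_weight μ 0 0 hr)
    (fun s _ => (weight_pos _ _ _ _).le)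
    (Or.inl fun s hs => mul_nonneg (weight_pos _ _ _ _).le (by
      have := hr.trans hs.1
      positivity))
    (fun s _ => hasDerivAt_const s 0) continuousOn_const continuousOn_const
    (fun s hs => by
      have hσ := mul_nonneg (weight_pos μ 0 0 s).le
        (h.source_nonneg s ⟨hr.trans hs.1, hs.2.trans ht⟩)
      have h1 := hk s hs
      have h2 : (1 + s) ≠ 0 := by linarith [hr.trans hs.1]
      have e : (weight μ 0 0 s * (0 + μ / (1 + s) + 0 / (1 + s) ^ 2)
          - weight μ 0 0 s * (μ / (1 + s)) + 0) = 0 := by ring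
      rw [e]
      linarith)
  simp only [intervalIntegral.integral_const, smul_eq_mul] at key
  linarith

/-- At a time that depends on `μ` and `ν` only, the derivative is bounded below by the data. -/
theorem le_deriv (h : IsSupersolution μ ν T σ U D) (hμ : 0 ≤ μ) (hδ : 0 ≤ delta μ ν)
    {b : ℝ} (hb : b = (μ - 1 - √(delta μ ν)) / 2)
    (hU0 : 0 ≤ U 0) (hV0 : 0 < D 0 + b * U 0) {τ : ℝ} (hτ1 : 1 ≤ τ) (hτ2 : 2 * ν ^ 2 ≤ 1 + τ)
    (hτ3 : 4 * |b| / Real.exp (-|b| * Real.log 2) ≤ 1 + τ) (hτT : τ + 1 ≤ T) :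
    weight μ 0 0 τ / weight μ 0 0 (τ + 1) * (Real.exp (-|b| * Real.log 2) / 4)
      * (Real.exp (-(1 + √(delta μ ν)) * Real.log 2) / weight b 0 0 τ) * (D 0 + b * U 0)
      ≤ D (τ + 1) := by
  -- κ = 2^{-|b|} bounds the factor by which `U` can shrink on [τ, τ+1], because there 1 + s ≤ 2(1 +
  -- τ).
  set κ := Real.exp (-|b| * Real.log 2) with hκ
  have hκ0 : 0 < κ := Real.exp_pos _
  have hU := h.nonneg hμ hδ rfl hb hU0 hV0
  have hτ0 : 0 ≤ τ := by linarith
  have hs0 : 0 < 1 + τ := by linarith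
  have hUτ := hU τ ⟨hτ0, by linarith⟩
  have h1 := h.weight_mul_deriv_mono hμ (r := τ) (t := τ + 1)
    (k := weight μ 0 0 τ * (1 / 2 * (κ * U τ))) hτ0 (by linarith) hτT (fun s hs => by
      have hs1 : 0 < 1 + s := by linarith [hs.1]
      have hw : weight μ 0 0 τ ≤ weight μ 0 0 s := by
        simp only [weight]
        rw [Real.exp_le_exp]
        have : Real.log (1 + τ) ≤ Real.log (1 + s) := Real.log_le_log hs0 (by linarith [hs.1])
        simp only [zero_mul, zero_div, zero_add, sub_zero]
        exact mul_le_mul_of_nonneg_left this hμ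
      have hc : 1 / 2 ≤ 1 - ν ^ 2 / (1 + s) ^ 2 := by
        have : ν ^ 2 / (1 + s) ^ 2 ≤ 1 / 2 := by
          rw [div_le_div_iff₀ (by positivity) two_pos]
          nlinarith [hs.1]
        linarith
      have hUs : κ * U τ ≤ U s := by
        have h2 := h.weight_mul_mono hμ hδ hb hU0 hV0 hτ0 hs.1 (hs.2.trans hτT)
        have h3 : κ * weight b 0 0 s ≤ weight b 0 0 τ := by
          simp only [weight, hκ]
          rw [← Real.exp_add, Real.exp_le_exp]
          have l1 : Real.log (1 + τ) ≤ Real.log (1 + s) := Real.log_le_log hs0 (by linarith [hs.1])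
          have l2 : Real.log (1 + s) ≤ Real.log 2 + Real.log (1 + τ) := by
            rw [← Real.log_mul two_ne_zero hs0.ne']
            exact Real.log_le_log hs1 (by linarith [hs.2])
          have : b * (Real.log (1 + s) - Real.log (1 + τ)) ≤ |b| * Real.log 2 := by
            refine (mul_le_mul_of_nonneg_right (le_abs_self b) (by linarith)).trans ?_
            exact mul_le_mul_of_nonneg_left (by linarith) (abs_nonneg b)
          simp only [zero_mul, zero_div, zero_add, sub_zero]
          linarith
        have h4 := mul_le_mul_of_nonneg_right h3 hUτ
        refine le_of_mul_le_mul_left ?_ (weight_pos b 0 0 s)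
        linarith
      exact mul_le_mul hw (mul_le_mul hc hUs (by positivity) (by linarith)) (by positivity)
        (weight_pos _ _ _ _).le)
  -- `D τ` may be negative, but not below -b/(1+τ) U(τ) ≥ -(κ/4) U(τ). The unit interval adds κ/2
  -- U(τ), up to the weight, so a net κ/4 U(τ) is left.
  have h2 := h.factor_pos hμ hδ hb hU0 hV0 (t := τ) ⟨hτ0, by linarith⟩
  have h3 := h.le_weight_mul hμ hδ hb hU0 hV0 hτ1 (by linarith)
  have h4 : b / (1 + τ) ≤ κ / 4 := by
    rw [div_le_iff₀ hκ0] at hτ3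
    rw [div_le_div_iff₀ hs0 (by norm_num)]
    linarith [le_abs_self b]
  have h5 : κ / 4 * U τ ≤ D τ + 1 / 2 * (κ * U τ) := by
    have := mul_le_mul_of_nonneg_right h4 hUτ
    linarith
  have h6 : weight μ 0 0 τ * (κ / 4 * U τ) ≤ weight μ 0 0 (τ + 1) * D (τ + 1) := by
    have := mul_le_mul_of_nonneg_left h5 (weight_pos μ 0 0 τ).le
    linarith
  have hw1 := weight_pos μ 0 0 (τ + 1)
  have hw2 := weight_pos b 0 0 τ
  have hw3 := weight_pos μ 0 0 τ
  have h7 : Real.exp (-(1 + √(delta μ ν)) * Real.log 2) / weight b 0 0 τ * (D 0 + b * U 0)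
      ≤ U τ := by
    rw [div_mul_eq_mul_div, div_le_iff₀ hw2]
    linarith
  calc _ = weight μ 0 0 τ / weight μ 0 0 (τ + 1) * (κ / 4) *
        (Real.exp (-(1 + √(delta μ ν)) * Real.log 2) / weight b 0 0 τ * (D 0 + b * U 0)) := by ring
    _ ≤ weight μ 0 0 τ / weight μ 0 0 (τ + 1) * (κ / 4) * U τ := by gcongr
    _ = (weight μ 0 0 τ * (κ / 4 * U τ)) / weight μ 0 0 (τ + 1) := by ring
    _ ≤ D (τ + 1) := by
      rw [div_le_iff₀ hw1]
      linarith

/-! ### Large times: isolating the derivative -/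

/-- The margin 1/16 lets the constant coefficients dominate the decaying ones; in particular 1 -
1/16 ≥ (3/4)(1 + 1/16), as the comparison for `D` requires. -/
theorem large_time_bounds {μ ν τ s : ℝ} (hμ : 0 ≤ μ)
    (hτ : 16 * (ν ^ 2 + μ / 2 + 1) ≤ 1 + τ) (hs : τ ≤ s) :
    0 < 1 + s ∧ (0 ≤ μ / 2 / (1 + s) ∧ μ / 2 / (1 + s) ≤ 1 / 16) ∧
      (0 ≤ (ν ^ 2 + μ / 2) / (1 + s) ^ 2 ∧ (ν ^ 2 + μ / 2) / (1 + s) ^ 2 ≤ 1 / 16) ∧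
      (0 ≤ ν ^ 2 / (1 + s) ^ 2 ∧ ν ^ 2 / (1 + s) ^ 2 ≤ 1 / 16) := by
  have hν := sq_nonneg ν
  have h1 : 16 ≤ 1 + s := by nlinarith
  have h0 : 0 < 1 + s := by linarith
  refine ⟨h0, ⟨by positivity, ?_⟩, ⟨by positivity, ?_⟩, ⟨by positivity, ?_⟩⟩
  · rw [div_le_div_iff₀ h0 (by norm_num)]
    nlinarith
  · rw [div_le_div_iff₀ (by positivity) (by norm_num)]
    nlinarith
  · rw [div_le_div_iff₀ (by positivity) (by norm_num)]
    nlinarith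

theorem deriv_nonneg_of_large (h : IsSupersolution μ ν T σ U D) (hμ : 0 ≤ μ)
    (hU : ∀ t ∈ Icc 0 T, 0 ≤ U t) {τ d : ℝ} (hτ : 16 * (ν ^ 2 + μ / 2 + 1) ≤ 1 + τ)
    (hd : 0 ≤ d) (hDτ : d ≤ D τ) {t : ℝ} (ht : t ∈ Icc τ T) : 0 ≤ D t := by
  have hτ0 : 0 ≤ τ := by nlinarith [sq_nonneg ν]
  have := h.weight_mul_deriv_mono hμ (k := 0) hτ0 ht.1 ht.2 (fun s hs => by
    obtain ⟨-, -, -, -, hv⟩ := large_time_bounds hμ hτ hs.1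
    exact mul_nonneg (weight_pos _ _ _ _).le (mul_nonneg (by linarith)
      (hU s ⟨hτ0.trans hs.1, hs.2.trans ht.2⟩)))
  have h1 := mul_nonneg (weight_pos μ 0 0 τ).le (hd.trans hDτ)
  exact (mul_nonneg_iff_of_pos_left (weight_pos μ 0 0 t)).1 (by linarith)

/-- The weight mimics e^{-t} (1+t)^{μ/2}, adapted to the growing mode of the linear equation. The
coefficient of `U` on the right is chosen so that all terms in `D` cancel in the tested inequality.
The factor e^{-c/(1+t)} with c = ν² + μ/2 compensates the errors of order (1+t)^{-2}. -/
theorem weight_integral_le (h : IsSupersolution μ ν T σ U D) (hμ : 0 ≤ μ)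
    (hU : ∀ t ∈ Icc 0 T, 0 ≤ U t) {τ d : ℝ} (hτ : 16 * (ν ^ 2 + μ / 2 + 1) ≤ 1 + τ)
    (hDτ : d ≤ D τ) {t : ℝ} (ht : t ∈ Icc τ T) :
    weight (μ / 2) (-1) (ν ^ 2 + μ / 2) τ * d
        + ∫ s in τ..t, weight (μ / 2) (-1) (ν ^ 2 + μ / 2) s * σ s
      ≤ weight (μ / 2) (-1) (ν ^ 2 + μ / 2) t
        * (D t + (1 + μ / 2 / (1 + t) - (ν ^ 2 + μ / 2) / (1 + t) ^ 2) * U t) := by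
  have hτ0 : 0 ≤ τ := by nlinarith [sq_nonneg ν]
  set c := ν ^ 2 + μ / 2 with hc
  have hc0 : 0 ≤ c := by positivity
  have hpos : ∀ s ∈ Icc τ t, (1 + s) ≠ 0 := fun s hs => by linarith [hs.1]
  have key := h.integral_le_of_weights hτ0 ht.1 ht.2 (η := weight (μ / 2) (-1) c)
    (η' := fun s => weight (μ / 2) (-1) c s * (-1 + μ / 2 / (1 + s) + c / (1 + s) ^ 2))
    (ζ := fun s => weight (μ / 2) (-1) c s * (1 + μ / 2 / (1 + s) - c / (1 + s) ^ 2))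
    (ζ' := fun s => weight (μ / 2) (-1) c s * (-1 + μ / 2 / (1 + s) + c / (1 + s) ^ 2)
        * (1 + μ / 2 / (1 + s) - c / (1 + s) ^ 2)
      + weight (μ / 2) (-1) c s * (-(μ / 2 / (1 + s) ^ 2) + 2 * c / (1 + s) ^ 3))
    (q := fun s => weight (μ / 2) (-1) c s * σ s)
    (fun s hs => hasDerivAt_weight _ _ _ (hτ0.trans hs.1)) (continuousOn_deriv_weight _ _ _ hτ0)
    (fun s _ => (weight_pos _ _ _ _).le)
    (Or.inr fun s hs => mul_nonpos_of_nonneg_of_nonpos (weight_pos _ _ _ _).le (by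
      obtain ⟨-, ⟨-, hx⟩, ⟨-, hy⟩, -⟩ := large_time_bounds hμ hτ hs.1
      linarith))
    (fun s hs => by
      have h1 := hpos s hs
      have hd : HasDerivAt (fun s : ℝ => 1 + s) 1 s := (hasDerivAt_id s).const_add 1
      refine ((hasDerivAt_weight (μ / 2) (-1) c (hτ0.trans hs.1)).mul
        ((((hasDerivAt_const s (μ / 2)).div hd h1).const_add 1).sub
        ((hasDerivAt_const s c).div (hd.pow 2) (pow_ne_zero 2 h1)))).congr_deriv ?_
      simp only [Pi.div_apply, Pi.pow_apply, Pi.sub_apply]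
      field_simp
      ring)
    (by
      have c1 : ContinuousOn (fun s => μ / 2 / (1 + s)) (Icc τ t) :=
        continuousOn_const.div (by fun_prop) hpos
      have c2 : ContinuousOn (fun s => c / (1 + s) ^ 2) (Icc τ t) :=
        continuousOn_const.div (by fun_prop) fun s hs => pow_ne_zero 2 (hpos s hs)
      have c3 : ContinuousOn (fun s => μ / 2 / (1 + s) ^ 2) (Icc τ t) :=
        continuousOn_const.div (by fun_prop) fun s hs => pow_ne_zero 2 (hpos s hs)
      have c4 : ContinuousOn (fun s => 2 * c / (1 + s) ^ 3) (Icc τ t) :=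
        continuousOn_const.div (by fun_prop) fun s hs => pow_ne_zero 3 (hpos s hs)
      have c5 := continuousOn_weight (μ / 2) (-1) c (t := t) hτ0
      fun_prop)
    ((continuousOn_weight _ _ _ hτ0).mul (h.continuousOn_source.mono (Icc_subset_Icc hτ0 ht.2)))
    (fun s hs => by
      obtain ⟨h1, ⟨hx0, hx⟩, ⟨hy0, hy⟩, -⟩ := large_time_bounds hμ hτ hs.1
      have hw := (weight_pos (μ / 2) (-1) c s).le
      have hUs := hU s ⟨hτ0.trans hs.1, hs.2.trans ht.2⟩
      have hd0 : 0 ≤ 2 * c / (1 + s) ^ 3 := by positivity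
      have e : (weight (μ / 2) (-1) c s * (-1 + μ / 2 / (1 + s) + c / (1 + s) ^ 2)
          - weight (μ / 2) (-1) c s * (μ / (1 + s))
          + weight (μ / 2) (-1) c s * (1 + μ / 2 / (1 + s) - c / (1 + s) ^ 2)) = 0 := by ring
      have ev : ν ^ 2 / (1 + s) ^ 2 + μ / 2 / (1 + s) ^ 2 = c / (1 + s) ^ 2 := by
        rw [hc]
        ring
      -- With x = (μ/2)/(1+s) and y = c/(1+s)², the product is x² - (1-y)², and by `ev` the bracket
      -- equals x² + y - y² + 2c/(1+s)³, non-negative since y ≤ 1.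
      have hbr : 0 ≤ (1 - ν ^ 2 / (1 + s) ^ 2) + ((-1 + μ / 2 / (1 + s) + c / (1 + s) ^ 2)
          * (1 + μ / 2 / (1 + s) - c / (1 + s) ^ 2)
          + (-(μ / 2 / (1 + s) ^ 2) + 2 * c / (1 + s) ^ 3)) := by
        nlinarith
      have := mul_nonneg (mul_nonneg hw hbr) hUs
      rw [e]
      linarith)
  have hw0 := (weight_pos (μ / 2) (-1) c τ).le
  obtain ⟨h1, ⟨hx0, hx⟩, ⟨hy0, hy⟩, -⟩ := large_time_bounds hμ hτ le_rfl
  have h2 : d ≤ D τ + (1 + μ / 2 / (1 + τ) - c / (1 + τ) ^ 2) * U τ := by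
    have := mul_nonneg (a := (1 + μ / 2 / (1 + τ) - c / (1 + τ) ^ 2)) (by linarith)
      (hU τ ⟨hτ0, ht.1.trans ht.2⟩)
    linarith
  have h3 := mul_le_mul_of_nonneg_left h2 hw0
  linarith

/-- The weighted derivative dominates a quarter of its lower solution. -/
theorem weight_integral_le_deriv (h : IsSupersolution μ ν T σ U D) (hμ : 0 ≤ μ)
    (hU : ∀ t ∈ Icc 0 T, 0 ≤ U t) {τ d : ℝ} (hτ : 16 * (ν ^ 2 + μ / 2 + 1) ≤ 1 + τ)
    (hd : 0 ≤ d) (hDτ : d ≤ D τ) {t : ℝ} (ht : t ∈ Icc τ T) :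
    (weight (μ / 2) (-1) (ν ^ 2 + μ / 2) τ * d
        + ∫ s in τ..t, weight (μ / 2) (-1) (ν ^ 2 + μ / 2) s * σ s) / 4
      ≤ weight (μ / 2) (-1) (ν ^ 2 + μ / 2) t * D t := by
  have hτ0 : 0 ≤ τ := by nlinarith [sq_nonneg ν]
  set c := ν ^ 2 + μ / 2 with hc
  set m := weight (μ / 2) (-1) c with hm
  set F : ℝ → ℝ := fun t => m τ * d + ∫ s in τ..t, m s * σ s with hF
  have hσc : ContinuousOn (fun s => m s * σ s) (Icc τ t) :=
    (continuousOn_weight _ _ _ hτ0).mul (h.continuousOn_source.mono (Icc_subset_Icc hτ0 ht.2))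
  have hu : uIcc τ t = Icc τ t := uIcc_of_le ht.1
  have hFc : ContinuousOn F (Icc τ t) := by
    have := intervalIntegral.continuousOn_primitive_interval' (μ := volume)
      (hu ▸ hσc : ContinuousOn _ (uIcc τ t)).intervalIntegrable left_mem_uIcc
    rw [hu] at this
    exact continuousOn_const.add this
  have hFd : ∀ s ∈ Ioo τ t, HasDerivAt F (m s * σ s) s := by
    intro s hs
    have hn : Icc τ t ∈ nhds s := Icc_mem_nhds hs.1 hs.2
    refine (intervalIntegral.integral_hasDerivAt_right ?_ ?_ (hσc.continuousAt hn)).const_add _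
    · apply ContinuousOn.intervalIntegrable
      rw [uIcc_of_le hs.1.le]
      exact hσc.mono (Icc_subset_Icc_right hs.2.le)
    · exact hσc.stronglyMeasurableAtFilter_nhdsWithin measurableSet_Icc s |>.filter_mono (by
        rw [nhdsWithin_eq_nhds.2 hn])
  have hexp : ∀ s, weight (μ / 2) 2 c s = weight 0 3 0 s * m s := by
    intro s
    simp only [hm, weight]
    rw [← Real.exp_add]
    congr 1
    ring
  have hqc : ContinuousOn (fun s => weight 0 3 0 s * (3 / 4 * F s + m s * σ s / 4))
      (Icc τ t) := by
    have := continuousOn_weight 0 3 0 (t := t) hτ0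
    fun_prop
  -- The previous lemma controls only a combination of `D` and `U`, whereas the source involves `D`
  -- alone. The extra factor e^{3s} turns the comparison of mD with F/4 into one of derivatives:
  -- (e^{3s} F/4)' = e^{3s} (3F/4 + mσ/4), and 3F/4 is absorbed by the linear terms.
  have key := h.integral_le_of_weights hτ0 ht.1 ht.2 (η := weight (μ / 2) 2 c)
    (η' := fun s => weight (μ / 2) 2 c s * (2 + μ / 2 / (1 + s) + c / (1 + s) ^ 2))
    (ζ := fun _ => 0) (ζ' := fun _ => 0)
    (q := fun s => weight 0 3 0 s * (3 / 4 * F s + m s * σ s / 4))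
    (fun s hs => hasDerivAt_weight _ _ _ (hτ0.trans hs.1)) (continuousOn_deriv_weight _ _ _ hτ0)
    (fun s _ => (weight_pos _ _ _ _).le)
    (Or.inl fun s hs => mul_nonneg (weight_pos _ _ _ _).le (by
      obtain ⟨-, ⟨hx, -⟩, ⟨hy, -⟩, -⟩ := large_time_bounds hμ hτ hs.1
      linarith))
    (fun s _ => hasDerivAt_const s 0) continuousOn_const hqc
    (fun s hs => by
      have hsT : s ∈ Icc τ T := ⟨hs.1, hs.2.trans ht.2⟩
      have hs0 : s ∈ Icc 0 T := ⟨hτ0.trans hs.1, hsT.2⟩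
      obtain ⟨h1, ⟨hx0, hx⟩, ⟨hy0, hy⟩, ⟨hv0, hv⟩⟩ := large_time_bounds hμ hτ hs.1
      have hDs := h.deriv_nonneg_of_large hμ hU hτ hd hDτ hsT
      have hFs := h.weight_integral_le hμ hU hτ hDτ hsT
      change F s ≤ m s * _ at hFs
      have hm0 := weight_pos (μ / 2) (-1) c s
      have h2 : 3 / 4 * (D s + (1 + μ / 2 / (1 + s) - c / (1 + s) ^ 2) * U s) ≤
          (2 + μ / 2 / (1 + s) + c / (1 + s) ^ 2 - μ / (1 + s)) * D s
            + (1 - ν ^ 2 / (1 + s) ^ 2) * U s := by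
        have e : μ / (1 + s) = 2 * (μ / 2 / (1 + s)) := by ring
        have i1 : 0 ≤ (2 + μ / 2 / (1 + s) + c / (1 + s) ^ 2 - μ / (1 + s) - 3 / 4) * D s :=
          mul_nonneg (by rw [e]; linarith) hDs
        have i2 : 0 ≤ ((1 - ν ^ 2 / (1 + s) ^ 2)
            - 3 / 4 * (1 + μ / 2 / (1 + s) - c / (1 + s) ^ 2)) * U s :=
          mul_nonneg (by linarith) (hU s hs0)
        linarith
      have h3 := mul_le_mul_of_nonneg_left h2 hm0.le
      have h4 := mul_nonneg hm0.le (h.source_nonneg s hs0)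
      have h5 : 3 / 4 * F s + m s * σ s / 4 ≤
          m s * ((2 + μ / 2 / (1 + s) + c / (1 + s) ^ 2 - μ / (1 + s)) * D s
            + (1 - ν ^ 2 / (1 + s) ^ 2) * U s) + m s * σ s := by
        change 0 ≤ m s * σ s at h4
        change m s * _ ≤ m s * _ at h3
        linarith
      refine (mul_le_mul_of_nonneg_left h5 (weight_pos 0 3 0 s).le).trans (le_of_eq ?_)
      rw [hexp]
      ring)
  have h6 : ∫ s in τ..t, weight 0 3 0 s * (3 / 4 * F s + m s * σ s / 4)
      = weight 0 3 0 t * (F t / 4) - weight 0 3 0 τ * (F τ / 4) := by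
    apply intervalIntegral.integral_eq_sub_of_hasDerivAt_of_le ht.1
      (f := fun s => weight 0 3 0 s * (F s / 4))
    · have := continuousOn_weight 0 3 0 (t := t) hτ0
      fun_prop
    · intro s hs
      refine ((hasDerivAt_weight 0 3 0 (hτ0.trans hs.1.le)).mul
        ((hFd s hs).div_const 4)).congr_deriv ?_
      ring
    · exact (hu.symm ▸ hqc : ContinuousOn _ (uIcc τ t)).intervalIntegrable
  have hFτ : F τ = m τ * d := by simp [hF]
  rw [h6, hexp, hexp, hFτ] at key
  have hw1 := weight_pos 0 3 0 t
  have hw2 := weight_pos 0 3 0 τ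
  have h7 : m τ * d / 4 ≤ m τ * D τ := by
    have i1 := mul_le_mul_of_nonneg_left hDτ (weight_pos (μ / 2) (-1) c τ).le
    have i2 := mul_nonneg (weight_pos (μ / 2) (-1) c τ).le hd
    change m τ * _ ≤ m τ * _ at i1
    change 0 ≤ m τ * _ at i2
    linarith
  have h8 := mul_le_mul_of_nonneg_left h7 hw2.le
  have h9 : weight 0 3 0 t * (F t / 4) ≤ weight 0 3 0 t * (m t * D t) := by linarith
  exact le_of_mul_le_mul_left h9 hw1

end IsSupersolution

/-! ### Blow-up of the comparison function and lifespan of supersolutions -/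

/-- A positive solution of `F' ≥ k Θ' F^p` lives only as long as `Θ` stays bounded. -/
theorem primitive_le_of_deriv_ge {r t p k : ℝ} (hrt : r ≤ t) (hp : 1 < p) {F F' Θ θ : ℝ → ℝ}
    (hF : ContinuousOn F (Icc r t)) (hF' : ∀ s ∈ Ioo r t, HasDerivAt F (F' s) s)
    (hΘ : ∀ s ∈ Icc r t, HasDerivAt Θ (θ s) s) (hpos : ∀ s ∈ Icc r t, 0 < F s)
    (hle : ∀ s ∈ Ioo r t, k * θ s * F s ^ p ≤ F' s) :
    (p - 1) * k * (Θ t - Θ r) ≤ F r ^ (1 - p) := by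
  have hΘc : ContinuousOn Θ (Icc r t) := fun s hs => (hΘ s hs).continuousAt.continuousWithinAt
  have hder : ∀ s ∈ Ioo r t, HasDerivAt (fun s => F s ^ (1 - p) + (p - 1) * k * Θ s)
      (F' s * (1 - p) * F s ^ (1 - p - 1) + (p - 1) * k * θ s) s := fun s hs =>
    ((hF' s hs).rpow_const (Or.inl (hpos s (Ioo_subset_Icc_self hs)).ne')).add
      ((hΘ s (Ioo_subset_Icc_self hs)).const_mul _)
  have hanti : AntitoneOn (fun s => F s ^ (1 - p) + (p - 1) * k * Θ s) (Icc r t) := by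
    apply antitoneOn_of_deriv_nonpos (convex_Icc r t)
    · exact (hF.rpow_const fun s hs => Or.inl (hpos s hs).ne').add (continuousOn_const.mul hΘc)
    · rw [interior_Icc]
      exact fun s hs => (hder s hs).differentiableAt.differentiableWithinAt
    · rw [interior_Icc]
      intro s hs
      rw [(hder s hs).deriv]
      have hFs := hpos s (Ioo_subset_Icc_self hs)
      have h1 : F s ^ p * F s ^ (1 - p - 1) = 1 := by
        rw [← Real.rpow_add hFs]
        simp
      have h2 := mul_le_mul_of_nonneg_right (hle s hs) (Real.rpow_nonneg hFs.le (1 - p - 1))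
      rw [mul_assoc, h1, mul_one] at h2
      nlinarith
  have h1 := hanti (left_mem_Icc.2 hrt) (right_mem_Icc.2 hrt) hrt
  have h2 := Real.rpow_nonneg (hpos t (right_mem_Icc.2 hrt)).le (1 - p)
  simp only at h1
  linarith


/-- The source `c₀ (e^t (1+t)^κ)^{-(p-1)} |D|^p` produced by the power nonlinearity. -/
noncomputable def powerSource (p κ c₀ : ℝ) (D : ℝ → ℝ) (s : ℝ) : ℝ :=
  c₀ * weight (-((p - 1) * κ)) (-(p - 1)) 0 s * |D s| ^ p

theorem primitive_bound_of_powerSource (μ ν p κ c₀ A₀ : ℝ) (hμ : 0 ≤ μ) (hδ : 0 ≤ delta μ ν)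
    (hp : 1 < p) (hc₀ : 0 < c₀) (hA₀ : 0 < A₀) :
    ∃ τ B : ℝ, 0 < τ ∧ 0 < B ∧ ∀ ε : ℝ, 0 < ε → ∀ (T : ℝ) (U D : ℝ → ℝ),
      IsSupersolution μ ν T (powerSource p κ c₀ D) U D → 0 ≤ U 0 →
      ε * A₀ ≤ D 0 + (μ - 1 - √(delta μ ν)) / 2 * U 0 → τ ≤ T →
      ∀ Θ : ℝ → ℝ, (∀ s, 0 ≤ s → HasDerivAt Θ (weight (-((κ + μ / 2) * (p - 1))) 0 0 s) s) →
        Θ T - Θ τ ≤ B * ε ^ (-(p - 1)) := by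
  set b := (μ - 1 - √(delta μ ν)) / 2 with hb
  -- The first summand provides the large-time bounds, the second makes b/(1+τ₀) small. The
  -- comparison starts at τ₀ + 1, where `le_deriv` bounds `D` below.
  set τ₀ := 16 * (ν ^ 2 + μ / 2 + 1) + 4 * |b| / Real.exp (-|b| * Real.log 2) with hτ₀
  have hq : 0 ≤ 4 * |b| / Real.exp (-|b| * Real.log 2) := by positivity
  have hν := sq_nonneg ν
  set c := ν ^ 2 + μ / 2 with hc
  set c₁ := weight μ 0 0 τ₀ / weight μ 0 0 (τ₀ + 1) * (Real.exp (-|b| * Real.log 2) / 4)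
      * (Real.exp (-(1 + √(delta μ ν)) * Real.log 2) / weight b 0 0 τ₀) with hc₁
  have hc₁0 : 0 < c₁ := by
    have h1 := weight_pos μ 0 0 τ₀
    have h2 := weight_pos μ 0 0 (τ₀ + 1)
    have h3 := weight_pos b 0 0 τ₀
    positivity
  set m := weight (μ / 2) (-1) c with hm
  set k := c₀ * (1 / 4) ^ p with hk
  have hk0 : 0 < k := by positivity
  set A := m (τ₀ + 1) * (c₁ * A₀) with hA
  have hA0 : 0 < A := mul_pos (weight_pos _ _ _ _) (by positivity)
  have hτpos : 0 < τ₀ + 1 := by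
    rw [hτ₀, hc]
    positivity
  refine ⟨τ₀ + 1, A ^ (1 - p) / ((p - 1) * k), hτpos,
    div_pos (Real.rpow_pos_of_pos hA0 _) (mul_pos (by linarith) hk0), ?_⟩
  intro ε hε T U D h hU0 hV0 hT Θ hΘ
  have hV0' : 0 < D 0 + b * U 0 := (mul_pos hε hA₀).trans_le hV0
  have hU := h.nonneg hμ hδ rfl hb hU0 hV0'
  have hD1 := h.le_deriv hμ hδ hb hU0 hV0' (τ := τ₀) (by rw [hτ₀, hc]; nlinarith)
    (by rw [hτ₀, hc]; nlinarith) (by rw [hτ₀, hc]; nlinarith) hT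
  set d := c₁ * (ε * A₀) with hd
  have hd0 : 0 < d := by positivity
  have hDτ : d ≤ D (τ₀ + 1) := (mul_le_mul_of_nonneg_left hV0 hc₁0.le).trans hD1
  set τ := τ₀ + 1 with hτ
  have hτl : 16 * (ν ^ 2 + μ / 2 + 1) ≤ 1 + τ := by rw [hτ, hτ₀]; linarith
  set F : ℝ → ℝ := fun t => m τ * d + ∫ s in τ..t, m s * powerSource p κ c₀ D s with hF
  have hσc : ContinuousOn (fun s => m s * powerSource p κ c₀ D s) (Icc τ T) :=
    (continuousOn_weight _ _ _ hτpos.le).mul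
      (h.continuousOn_source.mono (Icc_subset_Icc_left hτpos.le))
  have hu : uIcc τ T = Icc τ T := uIcc_of_le hT
  have hFc : ContinuousOn F (Icc τ T) := by
    have := intervalIntegral.continuousOn_primitive_interval' (μ := volume)
      (hu ▸ hσc : ContinuousOn _ (uIcc τ T)).intervalIntegrable left_mem_uIcc
    rw [hu] at this
    exact continuousOn_const.add this
  have hFd : ∀ s ∈ Ioo τ T, HasDerivAt F (m s * powerSource p κ c₀ D s) s := by
    intro s hs
    have hn : Icc τ T ∈ nhds s := Icc_mem_nhds hs.1 hs.2
    refine (intervalIntegral.integral_hasDerivAt_right ?_ ?_ (hσc.continuousAt hn)).const_add _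
    · apply ContinuousOn.intervalIntegrable
      rw [uIcc_of_le hs.1.le]
      exact hσc.mono (Icc_subset_Icc_right hs.2.le)
    · exact hσc.stronglyMeasurableAtFilter_nhdsWithin measurableSet_Icc s |>.filter_mono (by
        rw [nhdsWithin_eq_nhds.2 hn])
  have hFpos : ∀ s ∈ Icc τ T, 0 < F s := by
    intro s hs
    refine add_pos_of_pos_of_nonneg (mul_pos (weight_pos _ _ _ _) hd0) ?_
    apply intervalIntegral.integral_nonneg hs.1
    intro x hx
    exact mul_nonneg (weight_pos _ _ _ _).le
      (h.source_nonneg x ⟨hτpos.le.trans hx.1, hx.2.trans hs.2⟩)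
  have key := primitive_le_of_deriv_ge hT hp (k := k) hFc hFd
    (fun s hs => hΘ s (hτpos.le.trans hs.1)) hFpos (fun s hs => by
      have hs' := Ioo_subset_Icc_self hs
      have hs0 : 0 < 1 + s := by linarith [hs.1]
      have h1 : F s / 4 ≤ m s * D s := h.weight_integral_le_deriv hμ hU hτl hd0.le hDτ hs'
      have hms : 0 < m s := weight_pos _ _ _ _
      have hFs := hFpos s hs'
      have h2 : (F s / 4) ^ p ≤ m s ^ p * |D s| ^ p := by
        rw [← Real.mul_rpow hms.le (abs_nonneg _)]
        refine Real.rpow_le_rpow (by positivity) (h1.trans ?_) (by linarith)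
        exact mul_le_mul_of_nonneg_left (le_abs_self _) hms.le
      -- The factors e^{±(p-1)s} cancel and the powers of 1 + s match; the inequality only drops
      -- e^{c(p-1)/(1+s)} ≥ 1.
      have h3 : weight (-((κ + μ / 2) * (p - 1))) 0 0 s * m s ^ p ≤
          m s * weight (-((p - 1) * κ)) (-(p - 1)) 0 s := by
        simp only [hm, weight]
        rw [← Real.exp_mul, ← Real.exp_add, ← Real.exp_add, Real.exp_le_exp]
        have : 0 ≤ c / (1 + s) * (p - 1) := by
          have : 0 ≤ p - 1 := by linarith
          positivity
        simp only [zero_mul, zero_div, sub_zero, zero_add]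
        nlinarith
      calc k * weight (-((κ + μ / 2) * (p - 1))) 0 0 s * F s ^ p
          = c₀ * weight (-((κ + μ / 2) * (p - 1))) 0 0 s * (F s / 4) ^ p := by
            rw [show F s / 4 = F s * (1 / 4) by ring, Real.mul_rpow hFs.le (by norm_num), hk]
            ring
        _ ≤ c₀ * weight (-((κ + μ / 2) * (p - 1))) 0 0 s * (m s ^ p * |D s| ^ p) :=
            mul_le_mul_of_nonneg_left h2 (mul_nonneg hc₀.le (weight_pos _ _ _ _).le)
        _ = c₀ * (weight (-((κ + μ / 2) * (p - 1))) 0 0 s * m s ^ p) * |D s| ^ p := by ring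
        _ ≤ c₀ * (m s * weight (-((p - 1) * κ)) (-(p - 1)) 0 s) * |D s| ^ p := by gcongr
        _ = m s * powerSource p κ c₀ D s := by rw [powerSource]; ring)
  have hFτ : F τ = A * ε := by
    simp only [hF, hA, hd, intervalIntegral.integral_same]
    ring
  rw [hFτ, Real.mul_rpow hA0.le hε.le] at key
  have hp1 : 0 < (p - 1) * k := mul_pos (by linarith) hk0
  rw [div_mul_eq_mul_div, le_div_iff₀ hp1, neg_sub]
  linarith

theorem one_le_rpow_neg {ε x : ℝ} (hε : 0 < ε) (hε1 : ε ≤ 1) (hx : 0 ≤ x) : 1 ≤ ε ^ (-x) :=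
  Real.one_le_rpow_of_pos_of_le_one_of_nonpos hε hε1 (by linarith)

theorem lifespan_of_powerSource_subcritical (μ ν p κ c₀ A₀ : ℝ) (hμ : 0 ≤ μ)
    (hδ : 0 ≤ delta μ ν) (hp : 1 < p) (hc₀ : 0 < c₀) (hA₀ : 0 < A₀)
    (hθ : (κ + μ / 2) * (p - 1) < 1) :
    ∃ C : ℝ, 0 < C ∧ ∀ ε : ℝ, 0 < ε → ε ≤ 1 → ∀ (T : ℝ) (U D : ℝ → ℝ),
      IsSupersolution μ ν T (powerSource p κ c₀ D) U D → 0 ≤ U 0 →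
      ε * A₀ ≤ D 0 + (μ - 1 - √(delta μ ν)) / 2 * U 0 →
      T ≤ C * ε ^ (-((p - 1) / (1 - (κ + μ / 2) * (p - 1)))) := by
  obtain ⟨τ, B, hτ, hB, key⟩ := primitive_bound_of_powerSource μ ν p κ c₀ A₀ hμ hδ hp hc₀ hA₀
  set θ := (κ + μ / 2) * (p - 1)
  have h1θ : 0 < 1 - θ := by linarith
  set M := (1 + τ) ^ (1 - θ) + (1 - θ) * B with hM
  have hM0 : 0 < M := by positivity
  refine ⟨τ + M ^ (1 / (1 - θ)), by positivity, ?_⟩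
  intro ε hε hε1 T U D h hU0 hV0
  have he : 1 ≤ ε ^ (-((p - 1) / (1 - θ))) :=
    one_le_rpow_neg hε hε1 (div_nonneg (by linarith) h1θ.le)
  have hMp : 0 < M ^ (1 / (1 - θ)) := by positivity
  -- For T ≤ τ the summand τ of the constant suffices, since the negative power of ε ≤ 1 is at least
  -- 1.
  rcases le_total T τ with hT | hT
  · nlinarith
  · have h1 := key ε hε T U D h hU0 hV0 hT (fun s => (1 + s) ^ (1 - θ) / (1 - θ)) (by
      intro s hs
      have hs1 : 0 < 1 + s := by linarith
      have hd : HasDerivAt (fun s : ℝ => 1 + s) 1 s := (hasDerivAt_id s).const_add 1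
      refine ((hd.rpow_const (p := 1 - θ) (Or.inl hs1.ne')).div_const (1 - θ)).congr_deriv ?_
      rw [show 1 - θ - 1 = -θ by ring, Real.rpow_def_of_pos hs1]
      simp only [weight, zero_mul, zero_div, zero_add, sub_zero, one_mul]
      rw [mul_comm (Real.log _)]
      field_simp)
    have hT1 : 0 < 1 + T := by linarith
    have he1 : 1 ≤ ε ^ (-(p - 1)) := one_le_rpow_neg hε hε1 (by linarith)
    have h2 : (1 + T) ^ (1 - θ) ≤ M * ε ^ (-(p - 1)) := by
      rw [div_sub_div_same, div_le_iff₀ h1θ] at h1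
      have h3 : 0 ≤ (1 + τ) ^ (1 - θ) := by positivity
      have h4 := mul_le_mul_of_nonneg_left he1 h3
      rw [hM]
      linarith
    have h3 := Real.rpow_le_rpow (by positivity) h2 (one_div_nonneg.2 h1θ.le)
    rw [← Real.rpow_mul hT1.le, mul_one_div_cancel h1θ.ne', Real.rpow_one,
      Real.mul_rpow hM0.le (by positivity), ← Real.rpow_mul hε.le] at h3
    rw [show -(p - 1) * (1 / (1 - θ)) = -((p - 1) / (1 - θ)) by ring] at h3
    nlinarith

theorem lifespan_of_powerSource_critical (μ ν p κ c₀ A₀ : ℝ) (hμ : 0 ≤ μ)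
    (hδ : 0 ≤ delta μ ν) (hp : 1 < p) (hc₀ : 0 < c₀) (hA₀ : 0 < A₀)
    (hθ : (κ + μ / 2) * (p - 1) = 1) :
    ∃ C : ℝ, 0 < C ∧ ∀ ε : ℝ, 0 < ε → ε ≤ 1 → ∀ (T : ℝ) (U D : ℝ → ℝ),
      IsSupersolution μ ν T (powerSource p κ c₀ D) U D → 0 ≤ U 0 →
      ε * A₀ ≤ D 0 + (μ - 1 - √(delta μ ν)) / 2 * U 0 →
      T ≤ Real.exp (C * ε ^ (-(p - 1))) := by
  obtain ⟨τ, B, hτ, hB, key⟩ := primitive_bound_of_powerSource μ ν p κ c₀ A₀ hμ hδ hp hc₀ hA₀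
  rw [hθ] at key
  refine ⟨Real.log (1 + τ) + B, add_pos (Real.log_pos (by linarith)) hB, ?_⟩
  intro ε hε hε1 T U D h hU0 hV0
  have he1 : 1 ≤ ε ^ (-(p - 1)) := one_le_rpow_neg hε hε1 (by linarith)
  have hlog : 0 < Real.log (1 + τ) := Real.log_pos (by linarith)
  have h4 := mul_le_mul_of_nonneg_left he1 hlog.le
  have h5 := mul_le_mul_of_nonneg_left he1 hB.le
  rcases le_total T τ with hT | hT
  · calc T ≤ 1 + τ := by linarith
      _ = Real.exp (Real.log (1 + τ)) := (Real.exp_log (by linarith)).symm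
      _ ≤ _ := Real.exp_le_exp.2 (by linarith)
  · have h1 := key ε hε T U D h hU0 hV0 hT (fun s => Real.log (1 + s)) (by
      intro s hs
      have hs1 : 0 < 1 + s := by linarith
      have hd : HasDerivAt (fun s : ℝ => 1 + s) 1 s := (hasDerivAt_id s).const_add 1
      refine (hd.log hs1.ne').congr_deriv ?_
      simp only [weight, zero_mul, zero_div, zero_add, sub_zero, neg_mul, one_mul]
      rw [Real.exp_neg, Real.exp_log hs1, one_div])
    calc T ≤ 1 + T := by linarith
      _ = Real.exp (Real.log (1 + T)) := (Real.exp_log (by linarith)).symm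
      _ ≤ _ := Real.exp_le_exp.2 (by linarith)


/-! ### The plane exponential on balls, and Hölder's inequality -/

/-- The plane exponential `x ↦ e^{xᵢ}`, a positive eigenfunction of the Laplacian. -/
noncomputable def planeExp {N : ℕ} (i : Fin N) (x : Space N) : ℝ := Real.exp (x i)

theorem planeExp_pos {N : ℕ} (i : Fin N) (x : Space N) : 0 < planeExp i x := Real.exp_pos _

theorem contDiff_planeExp {N : ℕ} (i : Fin N) : ContDiff ℝ ∞ (planeExp i) := by
  unfold planeExp
  exact Real.contDiff_exp.comp (contDiff_piLp_apply 2 (i := i))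

theorem continuous_planeExp {N : ℕ} (i : Fin N) : Continuous (planeExp i) :=
  (contDiff_planeExp i).continuous

/-- On the ball of radius `ρ` the plane exponential is dominated by a product function. -/
noncomputable def planeExpMajorant {N : ℕ} (ρ : ℝ) (i j : Fin N) (y : ℝ) : ℝ :=
  if j = i then (Iic ρ).indicator (fun y => Real.exp (-(ρ / 2)) * Real.exp (1 / 2 * y)) y
  else Real.exp (-(1 / (4 * ρ)) * y ^ 2)

/-- In the ball, ∑_{j≠i} xⱼ² ≤ (ρ - xᵢ)(ρ + xᵢ) ≤ 2ρ(ρ - xᵢ). Half of the deficit ρ - xᵢ thus pays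
for Gaussians of width √ρ in the transverse variables, and the other half keeps exponential decay in
xᵢ. -/
theorem planeExp_le_majorant {N : ℕ} {ρ : ℝ} (hρ : 0 < ρ) (i : Fin N) {x : Space N}
    (hx : ‖x‖ ≤ ρ) :
    planeExp i x ≤ Real.exp ρ * ∏ j, planeExpMajorant ρ i j (x j) := by
  have hsq : ‖x‖ ^ 2 = x i ^ 2 + ∑ j ∈ Finset.univ.erase i, x j ^ 2 := by
    rw [EuclideanSpace.norm_sq_eq, ← Finset.add_sum_erase _ _ (Finset.mem_univ i)]
    simp
  have hxi : x i ≤ ρ :=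
    (le_abs_self _).trans (((Real.norm_eq_abs _) ▸ PiLp.norm_apply_le x i).trans hx)
  have hprod : ∏ j, planeExpMajorant ρ i j (x j) = Real.exp (-(ρ / 2) + 1 / 2 * x i
      + ∑ j ∈ Finset.univ.erase i, -(1 / (4 * ρ)) * x j ^ 2) := by
    rw [← Finset.mul_prod_erase _ _ (Finset.mem_univ i), Real.exp_add, Real.exp_add,
      Real.exp_sum]
    congr 1
    · rw [planeExpMajorant, if_pos rfl, indicator_of_mem (mem_Iic.2 hxi)]
    · refine Finset.prod_congr rfl fun j hj => ?_
      rw [planeExpMajorant, if_neg (Finset.ne_of_mem_erase hj)]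
  rw [hprod, ← Real.exp_add, planeExp, Real.exp_le_exp, ← Finset.mul_sum]
  have h1 : ∑ j ∈ Finset.univ.erase i, x j ^ 2 ≤ ρ ^ 2 - x i ^ 2 := by
    have := pow_le_pow_left₀ (norm_nonneg x) hx 2
    linarith
  have h2 : (1 / (4 * ρ)) * ∑ j ∈ Finset.univ.erase i, x j ^ 2 ≤ (ρ - x i) / 2 := by
    rw [div_mul_eq_mul_div, one_mul, div_le_div_iff₀ (by positivity) two_pos]
    nlinarith [mul_nonneg (sub_nonneg.2 hxi) (sub_nonneg.2 hxi)]
  linarith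

theorem integrable_planeExpMajorant {N : ℕ} {ρ : ℝ} (hρ : 0 < ρ) (i j : Fin N) :
    Integrable (planeExpMajorant ρ i j) := by
  by_cases h : j = i
  · have : planeExpMajorant ρ i j =
        (Iic ρ).indicator (fun y => Real.exp (-(ρ / 2)) * Real.exp (1 / 2 * y)) := by
      ext y
      rw [planeExpMajorant, if_pos h]
    rw [this]
    rw [integrable_indicator_iff measurableSet_Iic]
    exact (integrableOn_exp_mul_Iic (by norm_num) ρ).const_mul _
  · have : planeExpMajorant ρ i j = fun y => Real.exp (-(1 / (4 * ρ)) * y ^ 2) := by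
      ext y
      rw [planeExpMajorant, if_neg h]
    rw [this]
    exact integrable_exp_neg_mul_sq (by positivity)

theorem integral_planeExpMajorant {N : ℕ} {ρ : ℝ} (i j : Fin N) :
    ∫ y, planeExpMajorant ρ i j y = if j = i then 2 else √(4 * Real.pi * ρ) := by
  by_cases h : j = i
  · have : planeExpMajorant ρ i j =
        (Iic ρ).indicator (fun y => Real.exp (-(ρ / 2)) * Real.exp (1 / 2 * y)) := by
      ext y
      rw [planeExpMajorant, if_pos h]
    rw [this, integral_indicator measurableSet_Iic, integral_const_mul,
      integral_exp_mul_Iic (by norm_num), if_pos h, mul_div_assoc', ← Real.exp_add]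
    ring_nf
    simp
  · have : planeExpMajorant ρ i j = fun y => Real.exp (-(1 / (4 * ρ)) * y ^ 2) := by
      ext y
      rw [planeExpMajorant, if_neg h]
    rw [this, integral_gaussian, if_neg h]
    congr 1
    field_simp

/-- The majorant is a product, so Fubini gives 2 for the direction i and √(4πρ) for each of the N -
1 others. This is the origin of the exponent (N-1)/2. -/
theorem setIntegral_planeExp_le {N : ℕ} {ρ : ℝ} (hρ : 0 < ρ) (i : Fin N) :
    ∫ x in Metric.closedBall (0 : Space N) ρ, planeExp i x
      ≤ Real.exp ρ * (2 * (4 * Real.pi * ρ) ^ (((N : ℝ) - 1) / 2)) := by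
  have hmp := PiLp.volume_preserving_ofLp (Fin N)
  have hme : MeasurableEmbedding (WithLp.ofLp : Space N → Fin N → ℝ) :=
    (MeasurableEquiv.toLp 2 (Fin N → ℝ)).symm.measurableEmbedding
  have hint : Integrable (fun x : Space N => ∏ j, planeExpMajorant ρ i j (x j)) :=
    (hmp.integrable_comp_emb hme (g := fun y : Fin N → ℝ => ∏ j, planeExpMajorant ρ i j (y j))).2
      (Integrable.fintype_prod fun j => integrable_planeExpMajorant hρ i j)
  have hval : ∫ x : Space N, ∏ j, planeExpMajorant ρ i j (x j)
      = 2 * (4 * Real.pi * ρ) ^ (((N : ℝ) - 1) / 2) := by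
    have e := hmp.integral_comp hme (fun y : Fin N → ℝ => ∏ j, planeExpMajorant ρ i j (y j))
    rw [e, integral_fintype_prod_volume_eq_prod,
      ← Finset.mul_prod_erase _ _ (Finset.mem_univ i), integral_planeExpMajorant, if_pos rfl]
    congr 1
    rw [Finset.prod_congr rfl (g := fun _ => √(4 * Real.pi * ρ)) fun j hj => by
      rw [integral_planeExpMajorant, if_neg (Finset.ne_of_mem_erase hj)]]
    rw [Finset.prod_const, Finset.card_erase_of_mem (Finset.mem_univ i), Finset.card_univ,
      Fintype.card_fin, Real.sqrt_eq_rpow, ← Real.rpow_natCast, ← Real.rpow_mul (by positivity)]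
    congr 1
    rw [Nat.cast_sub (Nat.one_le_of_lt i.pos)]
    push_cast
    ring
  have hnonneg : ∀ x : Space N, 0 ≤ ∏ j, planeExpMajorant ρ i j (x j) := fun x =>
    Finset.prod_nonneg fun j _ => by
      unfold planeExpMajorant
      split_ifs
      · exact indicator_nonneg (fun y _ => by positivity) _
      · positivity
  calc ∫ x in Metric.closedBall (0 : Space N) ρ, planeExp i x
      ≤ ∫ x in Metric.closedBall (0 : Space N) ρ, Real.exp ρ * ∏ j, planeExpMajorant ρ i j (x j) := by
        apply setIntegral_mono_on
          ((continuous_planeExp i).continuousOn.integrableOn_compact (isCompact_closedBall 0 ρ))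
          (hint.const_mul _).integrableOn Metric.isClosed_closedBall.measurableSet
        intro x hx
        exact planeExp_le_majorant hρ i (by simpa using hx)
    _ ≤ ∫ x : Space N, Real.exp ρ * ∏ j, planeExpMajorant ρ i j (x j) :=
        setIntegral_le_integral (hint.const_mul _)
          (Filter.Eventually.of_forall fun x => mul_nonneg (Real.exp_pos _).le (hnonneg x))
    _ = _ := by rw [integral_const_mul, hval]

/-- Convexity of y^p in the form of Bernoulli's inequality, rescaled by a. -/
theorem rpow_tangent_le {a y p : ℝ} (ha : 0 ≤ a) (hy : 0 ≤ y) (hp : 1 < p) :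
    a ^ p + p * a ^ (p - 1) * (y - a) ≤ y ^ p := by
  rcases ha.eq_or_lt with rfl | ha
  · rw [Real.zero_rpow (by linarith), Real.zero_rpow (by linarith)]
    simpa using Real.rpow_nonneg hy p
  · have h := one_add_mul_self_le_rpow_one_add (s := y / a - 1) (by
      have := div_nonneg hy ha.le
      linarith) hp.le
    have h2 := mul_le_mul_of_nonneg_left h (Real.rpow_nonneg ha.le p)
    rw [add_sub_cancel, Real.div_rpow hy ha.le, mul_div_cancel₀ _ (Real.rpow_pos_of_pos ha p).ne']
      at h2
    have h3 : a ^ p = a ^ (p - 1) * a := by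
      rw [← Real.rpow_add_one ha.ne', sub_add_cancel]
    refine le_trans (le_of_eq ?_) h2
    rw [h3]
    field_simp

/-- A weighted form of Hölder's inequality. -/
theorem rpow_abs_integral_mul_le {α : Type*} [MeasurableSpace α] {m : Measure α} {y φ : α → ℝ}
    {p J : ℝ} (hp : 1 < p) (hφ : ∀ x, 0 ≤ φ x) (hJ : 0 < J) (hφi : Integrable φ m)
    (hφJ : ∫ x, φ x ∂m ≤ J) (h1 : Integrable (fun x => y x * φ x) m)
    (h2 : Integrable (fun x => |y x| ^ p * φ x) m) :
    J ^ (-(p - 1)) * |∫ x, y x * φ x ∂m| ^ p ≤ ∫ x, |y x| ^ p * φ x ∂m := by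
  set D := |∫ x, y x * φ x ∂m| with hD
  -- Integrating the tangent line at this point against φ gives p a^{p-1} D - (p-1) a^p J = a^p J =
  -- J^{-(p-1)} D^p.
  set a := D / J with ha
  have hD0 : 0 ≤ D := abs_nonneg _
  have ha0 : 0 ≤ a := div_nonneg hD0 hJ.le
  have hDa : D = a * J := by rw [ha]; field_simp
  have hDle : D ≤ ∫ x, |y x| * φ x ∂m := by
    refine (abs_integral_le_integral_abs).trans (le_of_eq ?_)
    congr 1
    ext x
    rw [abs_mul, abs_of_nonneg (hφ x)]
  have h1' : Integrable (fun x => |y x| * φ x) m := by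
    refine h1.abs.congr (Filter.Eventually.of_forall fun x => ?_)
    simp only [abs_mul, abs_of_nonneg (hφ x)]
  have key : ∫ x, (p * a ^ (p - 1) * (|y x| * φ x) - (p - 1) * a ^ p * φ x) ∂m
      ≤ ∫ x, |y x| ^ p * φ x ∂m := by
    apply integral_mono ((h1'.const_mul _).sub (hφi.const_mul _)) h2
    intro x
    have h := mul_le_mul_of_nonneg_right (rpow_tangent_le ha0 (abs_nonneg (y x)) hp) (hφ x)
    refine le_trans (le_of_eq ?_) h
    have e : a ^ (p - 1) * a = a ^ p := by
      rcases ha0.eq_or_lt with h0 | h0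
      · rw [← h0, Real.zero_rpow (by linarith : p ≠ 0), mul_zero]
      · rw [← Real.rpow_add_one h0.ne', sub_add_cancel]
    simp only [Pi.sub_apply]
    rw [← e]
    ring
  rw [integral_sub (h1'.const_mul _) (hφi.const_mul _), integral_const_mul,
    integral_const_mul] at key
  have e : a ^ (p - 1) * a = a ^ p := by
    rcases ha0.eq_or_lt with h0 | h0
    · rw [← h0, Real.zero_rpow (by linarith : p ≠ 0), mul_zero]
    · rw [← Real.rpow_add_one h0.ne', sub_add_cancel]
  have hap := Real.rpow_nonneg ha0 p
  have hap1 := Real.rpow_nonneg ha0 (p - 1)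
  have i1 : p * a ^ (p - 1) * D ≤ p * a ^ (p - 1) * ∫ x, |y x| * φ x ∂m :=
    mul_le_mul_of_nonneg_left hDle (by positivity)
  have i2 : (p - 1) * a ^ p * ∫ x, φ x ∂m ≤ (p - 1) * a ^ p * J :=
    mul_le_mul_of_nonneg_left hφJ (mul_nonneg (by linarith) hap)
  have i3 : p * a ^ (p - 1) * D = p * a ^ p * J := by
    rw [hDa, ← e]
    ring
  have i4 : J ^ (-(p - 1)) * D ^ p = a ^ p * J := by
    rw [hDa, Real.mul_rpow ha0 hJ.le, mul_left_comm, ← Real.rpow_add hJ]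
    congr 1
    rw [show -(p - 1) + p = 1 by ring, Real.rpow_one]
  rw [i4]
  linarith

/-- The integral of the plane exponential over the light cone at time `s`. -/
theorem setIntegral_planeExp_cone_le {N : ℕ} {R : ℝ} (hR : 0 < R) (i : Fin N) {s : ℝ}
    (hs : 0 ≤ s) :
    ∫ x in Metric.closedBall (0 : Space N) (s + R), planeExp i x
      ≤ (Real.exp R * (2 * (4 * Real.pi * (1 + R)) ^ (((N : ℝ) - 1) / 2)))
        * weight (((N : ℝ) - 1) / 2) 1 0 s := by
  have hN : 0 ≤ ((N : ℝ) - 1) / 2 := by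
    have : (1 : ℝ) ≤ N := by exact_mod_cast Nat.one_le_of_lt i.pos
    linarith
  have hs1 : 0 < 1 + s := by linarith
  refine (setIntegral_planeExp_le (by linarith) i).trans ?_
  have e : weight (((N : ℝ) - 1) / 2) 1 0 s
      = Real.exp s * (1 + s) ^ (((N : ℝ) - 1) / 2) := by
    simp only [weight]
    rw [Real.rpow_def_of_pos hs1, ← Real.exp_add]
    congr 1
    ring
  have h1 : (4 * Real.pi * (s + R)) ^ (((N : ℝ) - 1) / 2)
      ≤ (4 * Real.pi * (1 + R)) ^ (((N : ℝ) - 1) / 2) * (1 + s) ^ (((N : ℝ) - 1) / 2) := by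
    rw [← Real.mul_rpow (by positivity) hs1.le]
    apply Real.rpow_le_rpow (by positivity) _ hN
    rw [mul_assoc _ (1 + R)]
    apply mul_le_mul_of_nonneg_left _ (by positivity)
    nlinarith
  rw [e, Real.exp_add]
  have h2 := mul_le_mul_of_nonneg_left h1 (mul_pos (Real.exp_pos s) (Real.exp_pos R)).le
  linarith


/-! ### Cut-off, integration by parts and finite speed of propagation -/

variable {N : ℕ}

/-- The plane exponential, cut off smoothly outside a ball. -/
noncomputable def cutoffExp (i : Fin N) (χ : ContDiffBump (0 : Space N)) (x : Space N) : ℝ :=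
  χ x * planeExp i x

theorem contDiff_cutoffExp (i : Fin N) (χ : ContDiffBump (0 : Space N)) :
    ContDiff ℝ ∞ (cutoffExp i χ) :=
  χ.contDiff.mul (contDiff_planeExp i)

theorem continuous_cutoffExp (i : Fin N) (χ : ContDiffBump (0 : Space N)) :
    Continuous (cutoffExp i χ) := (contDiff_cutoffExp i χ).continuous

theorem hasCompactSupport_cutoffExp (i : Fin N) (χ : ContDiffBump (0 : Space N)) :
    HasCompactSupport (cutoffExp i χ) := χ.hasCompactSupport.mul_right

theorem cutoffExp_nonneg (i : Fin N) (χ : ContDiffBump (0 : Space N)) (x : Space N) :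
    0 ≤ cutoffExp i χ x := mul_nonneg χ.nonneg (planeExp_pos i x).le

theorem cutoffExp_eq (i : Fin N) (χ : ContDiffBump (0 : Space N)) {x : Space N}
    (hx : ‖x‖ ≤ χ.rIn) : cutoffExp i χ x = planeExp i x := by
  rw [cutoffExp, χ.one_of_mem_closedBall (by simpa using hx), one_mul]

theorem memLp_of_hasCompactSupport {E : Type*} [NormedAddCommGroup E] {ψ : Space N → E}
    (hc : Continuous ψ) (hs : HasCompactSupport ψ) : MemLp ψ 2 volume :=
  hc.memLp_of_hasCompactSupport hs

theorem fderiv_planeExp_single (i j : Fin N) (x : Space N) :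
    fderiv ℝ (planeExp i) x (EuclideanSpace.single j 1) = if j = i then planeExp i x else 0 := by
  have h : HasFDerivAt (planeExp i)
      (Real.exp (x i) • (EuclideanSpace.proj i : Space N →L[ℝ] ℝ)) x :=
    (EuclideanSpace.proj i : Space N →L[ℝ] ℝ).hasFDerivAt.exp
  rw [h.fderiv]
  by_cases hij : j = i
  · simp [hij, planeExp]
  · simp [hij, Ne.symm hij]

theorem gradient_apply_eq {ψ : Space N → ℝ} (x : Space N) (j : Fin N) :
    gradient ψ x j = fderiv ℝ ψ x (EuclideanSpace.single j 1) := by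
  have h : inner ℝ (gradient ψ x) (EuclideanSpace.single j (1 : ℝ))
      = fderiv ℝ ψ x (EuclideanSpace.single j 1) := inner_gradient_left
  rw [← h, EuclideanSpace.inner_single_right]
  simp

theorem contDiff_fderiv_apply {ψ : Space N → ℝ} (hψ : ContDiff ℝ ∞ ψ) (e : Space N) :
    ContDiff ℝ ∞ (fun x => fderiv ℝ ψ x e) :=
  (hψ.fderiv_right (m := ∞) le_rfl).clm_apply contDiff_const

theorem continuous_gradient {ψ : Space N → ℝ} (hψ : ContDiff ℝ ∞ ψ) :
    Continuous (gradient ψ) :=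
  (InnerProductSpace.toDual ℝ (Space N)).symm.continuous.comp
    (hψ.continuous_fderiv (by simp))

theorem hasCompactSupport_gradient {ψ : Space N → ℝ} (hψ : HasCompactSupport ψ) :
    HasCompactSupport (gradient ψ) :=
  (hψ.fderiv ℝ).comp_left (g := (InnerProductSpace.toDual ℝ (Space N)).symm) (map_zero _)

/-- Integration by parts in one coordinate direction. -/
theorem HasWeakGradient.integral_mul_gradient_apply {w : Space N → ℝ} {G : Space N → Space N}
    (h : HasWeakGradient w G) (hw : MemLp w 2 volume) (hG : MemLp G 2 volume)
    {ψ : Space N → ℝ} (hψ : ContDiff ℝ ∞ ψ) (hs : HasCompactSupport ψ) (j : Fin N) :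
    ∫ x, w x * gradient ψ x j = - ∫ x, ψ x * G x j := by
  have i1 : Integrable (fun x => w x • gradient ψ x) :=
    memLp_one_iff_integrable.1 (MemLp.smul (memLp_of_hasCompactSupport (continuous_gradient hψ)
      (hasCompactSupport_gradient hs)) hw)
  have i2 : Integrable (fun x => ψ x • G x) :=
    memLp_one_iff_integrable.1 (MemLp.smul hG (memLp_of_hasCompactSupport hψ.continuous hs))
  have e1 := (EuclideanSpace.proj j : Space N →L[ℝ] ℝ).integral_comp_comm i1
  have e2 := (EuclideanSpace.proj j : Space N →L[ℝ] ℝ).integral_comp_comm i2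
  have e := congrArg (EuclideanSpace.proj j : Space N →L[ℝ] ℝ) (h ψ hψ hs)
  rw [map_neg, ← e1, ← e2] at e
  simpa using e

/-- Integration by parts against the plane exponential. -/
theorem HasWeakGradient.integral_inner_gradient_cutoffExp {w : Space N → ℝ}
    {G : Space N → Space N} (h : HasWeakGradient w G) (hw : MemLp w 2 volume)
    (hG : MemLp G 2 volume) (i : Fin N) (χ : ContDiffBump (0 : Space N))
    (hsupp : ∀ᵐ x, χ.rIn ≤ ‖x‖ → w x = 0) :
    ∫ x, inner ℝ (G x) (gradient (cutoffExp i χ) x) = - ∫ x, w x * cutoffExp i χ x := by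
  set Ψ := cutoffExp i χ with hΨ
  have hΨd := contDiff_cutoffExp i χ
  have hΨs := hasCompactSupport_cutoffExp i χ
  have hd : ∀ j : Fin N, ContDiff ℝ ∞ (fun x => fderiv ℝ Ψ x (EuclideanSpace.single j 1)) :=
    fun j => contDiff_fderiv_apply hΨd _
  have hs : ∀ j : Fin N,
      HasCompactSupport (fun x => fderiv ℝ Ψ x (EuclideanSpace.single j 1)) :=
    fun j => (hΨs.fderiv_apply ℝ _)
  have hGj : ∀ j : Fin N, MemLp (fun x => G x j) 2 volume := fun j =>
    (EuclideanSpace.proj j : Space N →L[ℝ] ℝ).comp_memLp' hG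
  have hint : ∀ j : Fin N, Integrable
      (fun x => fderiv ℝ Ψ x (EuclideanSpace.single j 1) * G x j) := fun j =>
    (memLp_of_hasCompactSupport (hd j).continuous (hs j)).integrable_mul (hGj j)
  have e1 : ∫ x, inner ℝ (G x) (gradient Ψ x) =
      ∑ j, ∫ x, fderiv ℝ Ψ x (EuclideanSpace.single j 1) * G x j := by
    rw [← integral_finsetSum _ fun j _ => hint j]
    congr 1
    ext x
    rw [PiLp.inner_apply]
    refine Finset.sum_congr rfl fun j _ => ?_
    rw [gradient_apply_eq]
    simp
  have e2 : ∀ j : Fin N, ∫ x, fderiv ℝ Ψ x (EuclideanSpace.single j 1) * G x j =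
      if j = i then - ∫ x, w x * Ψ x else 0 := by
    intro j
    have h1 := h.integral_mul_gradient_apply hw hG (hd j) (hs j) j
    -- The integrand contains ∂ⱼ²Ψ. On the open ball of radius `χ.rIn` the cut-off is invisible to
    -- derivatives, so this is e^{xᵢ} for j = i and 0 otherwise; outside that ball w vanishes.
    have h2 : ∫ x, w x * gradient (fun x => fderiv ℝ Ψ x (EuclideanSpace.single j 1)) x j
        = ∫ x, if j = i then w x * Ψ x else 0 := by
      apply integral_congr_ae
      filter_upwards [hsupp] with x hx
      rcases lt_or_ge ‖x‖ χ.rIn with hlt | hge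
      · have ev : ∀ᶠ y in nhds x, y ∈ Metric.ball (0 : Space N) χ.rIn :=
          Metric.isOpen_ball.mem_nhds (by simpa using hlt)
        have ev1 : Ψ =ᶠ[nhds x] planeExp i := by
          filter_upwards [ev] with y hy
          exact cutoffExp_eq i χ (by simpa using (Metric.mem_ball.1 hy).le)
        have ev2 : (fun y => fderiv ℝ Ψ y (EuclideanSpace.single j 1)) =ᶠ[nhds x]
            fun y => if j = i then planeExp i y else 0 := by
          filter_upwards [ev1.fderiv (𝕜 := ℝ)] with y hy
          rw [hy, fderiv_planeExp_single]
        rw [gradient_apply_eq, ev2.fderiv_eq, hΨ, cutoffExp_eq i χ hlt.le]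
        by_cases hij : j = i
        · subst hij
          simp only [if_true]
          rw [fderiv_planeExp_single, if_pos rfl]
        · simp [hij]
      · simp [hx hge]
    rw [h2] at h1
    by_cases hij : j = i
    · simp only [hij, if_true] at h1 ⊢
      linarith
    · simp only [hij, if_false, integral_zero] at h1 ⊢
      linarith
  rw [e1, Finset.sum_congr rfl fun j _ => e2 j]
  simp

theorem inner_toLp_eq {Ψ : Space N → ℝ} (hΨ : MemLp Ψ 2 volume) (w : L2 N) :
    inner ℝ (hΨ.toLp Ψ) w = ∫ x, w x * Ψ x := by
  rw [L2.inner_def]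
  apply integral_congr_ae
  filter_upwards [hΨ.coeFn_toLp] with x hx
  rw [hx]
  simp

theorem exists_gt_mem_timeInterval {T : ℝ≥0∞} {t : ℝ} (ht : t ∈ timeInterval T) :
    ∃ t', t < t' ∧ ENNReal.ofReal t' < T := by
  obtain ⟨r, h1, h2⟩ := ENNReal.lt_iff_exists_nnreal_btwn.1 ht.2
  refine ⟨r, ?_, by simpa using h2⟩
  rw [← ENNReal.ofReal_coe_nnreal] at h1
  exact (ENNReal.ofReal_lt_ofReal_iff_of_nonneg ht.1).1 h1

theorem Icc_subset_timeInterval {T : ℝ≥0∞} {t : ℝ} (ht : ENNReal.ofReal t < T) :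
    Icc 0 t ⊆ timeInterval T := fun _ hs =>
  ⟨hs.1, (ENNReal.ofReal_le_ofReal hs.2).trans_lt ht⟩

/-- The time derivative is supported in a cone as well. -/
theorem SupportedInCone.deriv {R : ℝ} {T : ℝ≥0∞} {u : ℝ → L2 N} (h : SupportedInCone R T u)
    {t : ℝ} (ht : t ∈ timeInterval T) {w : L2 N}
    (hd : HasDerivWithinAt u w (timeInterval T) t) :
    ∀ᵐ x, t + (R + 1) < ‖x‖ → w x = 0 := by
  obtain ⟨t', htt', ht'T⟩ := exists_gt_mem_timeInterval ht
  -- The extra unit in the radius keeps u(τ) = 0 on A throughout a time interval [t, s] with s ≤ t +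
  -- 1. Pairing u(τ) with w·1_A and differentiating at t gives ∫_A w² = 0.
  set A : Set (Space N) := {x | t + (R + 1) < ‖x‖} with hA
  have hAm : MeasurableSet A := measurableSet_lt measurable_const measurable_norm
  have hwA : MemLp (A.indicator w) 2 volume := (Lp.memLp w).indicator hAm
  set s := min (t + 1) t' with hs
  have hts : t < s := lt_min (by linarith) htt'
  have hsub : Icc t s ⊆ timeInterval T := fun τ hτ =>
    Icc_subset_timeInterval ht'T ⟨ht.1.trans hτ.1, hτ.2.trans (min_le_right _ _)⟩
  have h0 : ∀ τ ∈ Icc t s, inner ℝ (hwA.toLp _) (u τ) = (0 : ℝ) := by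
    intro τ hτ
    rw [inner_toLp_eq]
    refine integral_eq_zero_of_ae ?_
    filter_upwards [h τ (hsub hτ)] with x hx
    by_cases hxA : x ∈ A
    · have h1 : t + (R + 1) < ‖x‖ := hxA
      have h2 : τ ≤ t + 1 := hτ.2.trans (min_le_left _ _)
      simp [hx (by linarith)]
    · simp [hxA]
  have hd1 : HasDerivWithinAt (fun τ => (innerSL ℝ (hwA.toLp _)) (u τ))
      ((innerSL ℝ (hwA.toLp _)) w) (Icc t s) t :=
    (innerSL ℝ (hwA.toLp _)).hasFDerivAt.comp_hasDerivWithinAt t (hd.mono hsub)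
  have hd2 : HasDerivWithinAt (fun τ => (innerSL ℝ (hwA.toLp _)) (u τ)) 0 (Icc t s) t :=
    (hasDerivWithinAt_const t (Icc t s) (0 : ℝ)).congr (fun τ hτ => h0 τ hτ)
      (h0 t (left_mem_Icc.2 hts.le))
  have heq := (uniqueDiffOn_Icc hts t (left_mem_Icc.2 hts.le)).eq_deriv _ hd1 hd2
  have heq' : inner ℝ (hwA.toLp _) w = (0 : ℝ) := heq
  rw [inner_toLp_eq] at heq'
  have hnn : 0 ≤ᵐ[volume] fun x => w x * A.indicator w x := by
    refine Filter.Eventually.of_forall fun x => ?_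
    by_cases hxA : x ∈ A
    · simp [hxA, mul_self_nonneg]
    · simp [hxA]
  have hz := (integral_eq_zero_iff_of_nonneg_ae hnn ((Lp.memLp w).integrable_mul hwA)).1 heq'
  filter_upwards [hz] with x hx hxA
  have hxA' : x ∈ A := hxA
  simpa [hxA'] using hx


/-! ### From energy solutions to scalar supersolutions -/

theorem isTestFunction_mul_cutoffExp {T : ℝ≥0∞} (η : ContDiffBump (0 : ℝ))
    (hη : ENNReal.ofReal η.rOut < T) (i : Fin N) (χ : ContDiffBump (0 : Space N)) :
    IsTestFunction T (fun z : ℝ × Space N => η z.1 * cutoffExp i χ z.2) := by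
  have hsub : Function.support (fun z : ℝ × Space N => η z.1 * cutoffExp i χ z.2) ⊆
      Metric.closedBall 0 η.rOut ×ˢ tsupport (cutoffExp i χ) := by
    intro z hz
    have hz' := mul_ne_zero_iff.1 (Function.mem_support.1 hz)
    refine ⟨?_, subset_tsupport _ hz'.2⟩
    have : z.1 ∈ Function.support η := hz'.1
    rw [η.support_eq] at this
    exact Metric.ball_subset_closedBall this
  have hcomp : IsCompact (Metric.closedBall (0 : ℝ) η.rOut ×ˢ tsupport (cutoffExp i χ)) :=
    (isCompact_closedBall _ _).prod (hasCompactSupport_cutoffExp i χ)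
  refine ⟨?_, ?_, ?_⟩
  · exact (η.contDiff.comp contDiff_fst).mul ((contDiff_cutoffExp i χ).comp contDiff_snd)
  · exact HasCompactSupport.of_support_subset_isCompact hcomp hsub
  · intro z hz
    have h1 := (closure_minimal hsub hcomp.isClosed hz).1
    have h2 : z.1 ≤ η.rOut := by
      have := Metric.mem_closedBall.1 h1
      rw [Real.dist_eq, sub_zero] at this
      exact (le_abs_self _).trans this
    exact (ENNReal.ofReal_le_ofReal h2).trans_lt hη

/-- The average of a function against the cut-off plane exponential. -/
noncomputable def expMean (i : Fin N) (χ : ContDiffBump (0 : Space N)) (u : ℝ → L2 N) (t : ℝ) : ℝ :=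
  ∫ x, u t x * cutoffExp i χ x

theorem memLp_cutoffExp (i : Fin N) (χ : ContDiffBump (0 : Space N)) :
    MemLp (cutoffExp i χ) 2 volume :=
  memLp_of_hasCompactSupport (continuous_cutoffExp i χ) (hasCompactSupport_cutoffExp i χ)

theorem expMean_eq_inner (i : Fin N) (χ : ContDiffBump (0 : Space N)) (u : ℝ → L2 N) :
    expMean i χ u = fun t => innerSL ℝ ((memLp_cutoffExp i χ).toLp _) (u t) := by
  ext t
  exact (inner_toLp_eq (memLp_cutoffExp i χ) (u t)).symm

theorem continuousOn_expMean (i : Fin N) (χ : ContDiffBump (0 : Space N)) {u : ℝ → L2 N}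
    {s : Set ℝ} (hu : ContinuousOn u s) : ContinuousOn (expMean i χ u) s := by
  rw [expMean_eq_inner]
  exact (innerSL ℝ _).continuous.comp_continuousOn hu

theorem hasDerivWithinAt_expMean (i : Fin N) (χ : ContDiffBump (0 : Space N)) {u ut : ℝ → L2 N}
    {s : Set ℝ} {t : ℝ} (hu : HasDerivWithinAt u (ut t) s t) :
    HasDerivWithinAt (expMean i χ u) (expMean i χ ut t) s t := by
  rw [expMean_eq_inner, expMean_eq_inner]
  exact (innerSL ℝ _).hasFDerivAt.comp_hasDerivWithinAt t hu

/-- The nonlinear term tested with the cut-off plane exponential. -/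
noncomputable def expSource (i : Fin N) (χ : ContDiffBump (0 : Space N)) (p : ℝ) (ut : ℝ → L2 N)
    (t : ℝ) : ℝ :=
  ∫ x, |ut t x| ^ p * cutoffExp i χ x

section

variable {μ ν p ε R T₁ : ℝ} {f g : Space N → ℝ} {T : ℝ≥0∞} {u ut : ℝ → L2 N} {Du : ℝ → L2Field N}
  {v : ℝ × Space N → ℝ}

/-- The strict inequality T₁ < `η.rIn` makes η equal to 1 near every point of [0, T₁], endpoint
included, so that η' vanishes there. -/
theorem exists_timeCutoff (hT₁ : 0 ≤ T₁) (hT : ENNReal.ofReal T₁ < T) :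
    ∃ η : ContDiffBump (0 : ℝ), T₁ < η.rIn ∧ ENNReal.ofReal η.rOut < T := by
  obtain ⟨t', h1, h2⟩ := exists_gt_mem_timeInterval ⟨hT₁, hT⟩
  exact ⟨⟨(T₁ + t') / 2, t', by linarith, by linarith⟩, by simp only; linarith, h2⟩

theorem timeCutoff_eventuallyEq_one (η : ContDiffBump (0 : ℝ)) {s : ℝ} (hs0 : 0 ≤ s)
    (hs : s < η.rIn) : η =ᶠ[nhds s] fun _ => 1 := by
  have : Metric.ball (0 : ℝ) η.rIn ∈ nhds s :=
    Metric.isOpen_ball.mem_nhds (by simpa [abs_of_nonneg hs0] using hs)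
  filter_upwards [this] with x hx
  exact η.one_of_mem_closedBall (Metric.ball_subset_closedBall hx)

/-- Testing the equation with the plane exponential gives an ordinary differential equation. -/
theorem IsEnergySolutionWith.expMean_eq (h : IsEnergySolutionWith μ ν p ε f g T u ut Du v)
    (hsupp : SupportedInCone R T u) (hT₁ : 0 ≤ T₁) (hT : ENNReal.ofReal T₁ < T) (i : Fin N)
    {χ : ContDiffBump (0 : Space N)} (hχ : T₁ + R < χ.rIn) {t : ℝ} (ht : t ∈ Icc 0 T₁) :
    expMean i χ ut t - expMean i χ ut 0
      - (∫ s in (0 : ℝ)..t, expMean i χ u s)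
      + (∫ s in (0 : ℝ)..t, μ / (1 + s) * expMean i χ ut s)
      + (∫ s in (0 : ℝ)..t, ν ^ 2 / (1 + s) ^ 2 * expMean i χ u s)
    = ∫ s in (0 : ℝ)..t, expSource i χ p ut s := by
  obtain ⟨η, hη1, hη2⟩ := exists_timeCutoff hT₁ hT
  have hsub := Icc_subset_timeInterval hT
  have hmem : ∀ s ∈ uIcc 0 t, s ∈ Icc 0 T₁ := fun s hs => by
    rw [uIcc_of_le ht.1] at hs
    exact ⟨hs.1, hs.2.trans ht.2⟩
  have hone : ∀ s ∈ Icc 0 T₁, η s = 1 := fun s hs =>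
    (timeCutoff_eventuallyEq_one η hs.1 (hs.2.trans_lt hη1)).eq_of_nhds
  have hw := h.weakIdentity _ (isTestFunction_mul_cutoffExp η hη2 i χ) t (hsub ht)
  unfold WeakIdentity at hw
  simp only at hw
  have e3 : ∫ s in (0 : ℝ)..t, ∫ x, ut s x * deriv (fun τ => η τ * cutoffExp i χ x) s = 0 := by
    rw [intervalIntegral.integral_congr (g := fun _ => (0 : ℝ))]
    · simp
    intro s hs
    have hs' := hmem s hs
    have hz : deriv η s = 0 := by
      rw [(timeCutoff_eventuallyEq_one η hs'.1 (hs'.2.trans_lt hη1)).deriv_eq]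
      simp
    have : ∀ x, deriv (fun τ => η τ * cutoffExp i χ x) s = 0 := fun x => by
      rw [deriv_mul_const_field, hz, zero_mul]
    simp [this]
  have e4 : ∫ s in (0 : ℝ)..t, ∫ x, inner ℝ (Du s x)
      (gradient (fun y => η s * cutoffExp i χ y) x) = - ∫ s in (0 : ℝ)..t, expMean i χ u s := by
    rw [← intervalIntegral.integral_neg]
    apply intervalIntegral.integral_congr
    intro s hs
    have hs' := hmem s hs
    simp only [hone s hs', one_mul]
    refine (h.hasWeakGradient s (hsub hs')).integral_inner_gradient_cutoffExp (Lp.memLp _)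
      (Lp.memLp _) i χ ?_
    filter_upwards [hsupp s (hsub hs')] with x hx hxχ
    exact hx (by linarith [hs'.2])
  have e5 : ∫ s in (0 : ℝ)..t, ∫ x, μ / (1 + s) * ut s x * (η s * cutoffExp i χ x)
      = ∫ s in (0 : ℝ)..t, μ / (1 + s) * expMean i χ ut s := by
    apply intervalIntegral.integral_congr
    intro s hs
    simp only [hone s (hmem s hs), one_mul, expMean, ← integral_const_mul, mul_assoc]
  have e6 : ∫ s in (0 : ℝ)..t, ∫ x, ν ^ 2 / (1 + s) ^ 2 * u s x * (η s * cutoffExp i χ x)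
      = ∫ s in (0 : ℝ)..t, ν ^ 2 / (1 + s) ^ 2 * expMean i χ u s := by
    apply intervalIntegral.integral_congr
    intro s hs
    simp only [hone s (hmem s hs), one_mul, expMean, ← integral_const_mul, mul_assoc]
  have e7 : ∫ s in (0 : ℝ)..t, ∫ x, |ut s x| ^ p * (η s * cutoffExp i χ x)
      = ∫ s in (0 : ℝ)..t, expSource i χ p ut s := by
    apply intervalIntegral.integral_congr
    intro s hs
    simp only [hone s (hmem s hs), one_mul, expSource]
  rw [e3, e4, e5, e6, e7, hone t ht, hone 0 ⟨le_rfl, hT₁⟩] at hw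
  simp only [one_mul] at hw
  rw [← hw]
  simp only [expMean]
  ring

/-- The slices `ut s` need not be jointly measurable in (s, x), so Fubini is applied to the
representative `v`. Without integrability in time the right side of the weak identity could be the
default value 0 of the integral. -/
theorem IsEnergySolutionWith.integrable_source
    (h : IsEnergySolutionWith μ ν p ε f g T u ut Du v) (hT₁ : 0 ≤ T₁)
    (hT : ENNReal.ofReal T₁ < T) (i : Fin N) (χ : ContDiffBump (0 : Space N)) :
    IntegrableOn (expSource i χ p ut) (Ioc 0 T₁) ∧
      ∀ᵐ s ∂(volume.restrict (Ioc 0 T₁)),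
        Integrable (fun x => |ut s x| ^ p * cutoffExp i χ x) := by
  obtain ⟨η, hη1, hη2⟩ := exists_timeCutoff hT₁ hT
  have hsub := Icc_subset_timeInterval hT
  have hone : ∀ s ∈ Icc 0 T₁, η s = 1 := fun s hs =>
    (timeCutoff_eventuallyEq_one η hs.1 (hs.2.trans_lt hη1)).eq_of_nhds
  have hi := h.integrableOn_nonlinearity _ (isTestFunction_mul_cutoffExp η hη2 i χ) T₁
    (hsub (right_mem_Icc.2 hT₁))
  rw [IntegrableOn, Measure.volume_eq_prod, ← Measure.prod_restrict, Measure.restrict_univ] at hi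
  have hae : ∀ᵐ s ∂(volume.restrict (Ioc 0 T₁)),
      (fun x => |v (s, x)| ^ p * (η s * cutoffExp i χ x)) =ᵐ[volume]
        fun x => |ut s x| ^ p * cutoffExp i χ x := by
    filter_upwards [ae_restrict_of_ae h.representative, ae_restrict_mem measurableSet_Ioc]
      with s hs hs1
    have hs2 : s ∈ Icc 0 T₁ := Ioc_subset_Icc_self hs1
    filter_upwards [hs (hsub hs2)] with x hx
    rw [hx, hone s hs2, one_mul]
  refine ⟨hi.integral_prod_left.congr ?_, ?_⟩
  · filter_upwards [hae] with s hs
    exact integral_congr_ae hs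
  · filter_upwards [hae, hi.prod_right_ae] with s hs hs'
    exact hs'.congr hs

/-- The constant in the bound of the integral of the plane exponential over the cone. -/
noncomputable def coneConst (N : ℕ) (R : ℝ) : ℝ :=
  Real.exp (R + 1) * (2 * (4 * Real.pi * (1 + (R + 1))) ^ (((N : ℝ) - 1) / 2))

theorem coneConst_pos (N : ℕ) {R : ℝ} (hR : 0 < R) : 0 < coneConst N R := by
  unfold coneConst
  positivity

/-- Hölder's inequality on the ball of radius s + R + 1, where the cut-off is 1. The radius R + 1,
in place of R, affects only the constant. -/
theorem powerSource_le_expSource (hR : 0 < R) (hp : 1 < p) (i : Fin N)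
    {χ : ContDiffBump (0 : Space N)} {s : ℝ} (hs : 0 ≤ s) (hχ : s + (R + 1) ≤ χ.rIn)
    (hsupp : ∀ᵐ x, s + (R + 1) < ‖x‖ → ut s x = 0)
    (hint : Integrable (fun x => |ut s x| ^ p * cutoffExp i χ x)) :
    powerSource p (((N : ℝ) - 1) / 2) (coneConst N R ^ (-(p - 1))) (expMean i χ ut) s
      ≤ expSource i χ p ut s := by
  set B := Metric.closedBall (0 : Space N) (s + (R + 1)) with hB
  have hBm : MeasurableSet B := Metric.isClosed_closedBall.measurableSet
  have hzero : ∀ᵐ x, x ∉ B → ut s x = 0 := by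
    filter_upwards [hsupp] with x hx hxB
    exact hx (by simpa [hB] using hxB)
  have hK := coneConst_pos N hR
  have hJ : 0 < coneConst N R * weight (((N : ℝ) - 1) / 2) 1 0 s := mul_pos hK (weight_pos _ _ _ _)
  have e1 : expMean i χ ut s = ∫ x in B, ut s x * cutoffExp i χ x := by
    rw [setIntegral_eq_integral_of_ae_compl_eq_zero]
    · rfl
    · filter_upwards [hzero] with x hx hxB
      rw [hx hxB, zero_mul]
  have e2 : expSource i χ p ut s = ∫ x in B, |ut s x| ^ p * cutoffExp i χ x := by
    rw [setIntegral_eq_integral_of_ae_compl_eq_zero]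
    · rfl
    · filter_upwards [hzero] with x hx hxB
      rw [hx hxB, abs_zero, Real.zero_rpow (by linarith), zero_mul]
  have hI : ∫ x in B, cutoffExp i χ x ≤ coneConst N R * weight (((N : ℝ) - 1) / 2) 1 0 s := by
    rw [setIntegral_congr_fun (g := planeExp i) hBm fun x hx => cutoffExp_eq i χ (by
      have : ‖x‖ ≤ s + (R + 1) := by simpa [hB] using hx
      linarith)]
    exact setIntegral_planeExp_cone_le (by linarith) i hs
  have key := rpow_abs_integral_mul_le (m := volume.restrict B) (y := ut s) hp
    (cutoffExp_nonneg i χ) hJ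
    ((continuous_cutoffExp i χ).integrable_of_hasCompactSupport
      (hasCompactSupport_cutoffExp i χ)).integrableOn hI
    ((Lp.memLp (ut s)).integrable_mul (memLp_cutoffExp i χ)).integrableOn hint.integrableOn
  rw [← e1, ← e2] at key
  refine le_trans (le_of_eq ?_) key
  rw [powerSource, Real.mul_rpow hK.le (weight_pos _ _ _ _).le]
  congr 2
  simp only [weight]
  rw [← Real.exp_mul]
  congr 1
  ring

theorem IsEnergySolutionWith.isSupersolution (h : IsEnergySolutionWith μ ν p ε f g T u ut Du v)
    (hsupp : SupportedInCone R T u) (hR : 0 < R) (hp : 1 < p) (hT₁ : 0 ≤ T₁)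
    (hT : ENNReal.ofReal T₁ < T) (i : Fin N)
    {χ : ContDiffBump (0 : Space N)} (hχ : T₁ + (R + 1) ≤ χ.rIn) :
    IsSupersolution μ ν T₁
      (powerSource p (((N : ℝ) - 1) / 2) (coneConst N R ^ (-(p - 1))) (expMean i χ ut))
      (expMean i χ u) (expMean i χ ut) := by
  have hsub := Icc_subset_timeInterval hT
  have hK := coneConst_pos N hR
  have hU : ContinuousOn (expMean i χ u) (Icc 0 T₁) :=
    continuousOn_expMean i χ (h.continuousOn.mono hsub)
  have hD : ContinuousOn (expMean i χ ut) (Icc 0 T₁) :=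
    continuousOn_expMean i χ (h.continuousOn_deriv.mono hsub)
  have hS : ContinuousOn
      (powerSource p (((N : ℝ) - 1) / 2) (coneConst N R ^ (-(p - 1))) (expMean i χ ut))
      (Icc 0 T₁) :=
    (continuousOn_const.mul (continuousOn_weight _ _ _ le_rfl)).mul
      (hD.abs.rpow_const fun s _ => Or.inr (by linarith))
  refine ⟨fun t ht => hasDerivWithinAt_expMean i χ ((h.hasDerivWithinAt t (hsub ht)).mono hsub),
    hD, hS, fun t _ => ?_, ?_⟩
  · unfold powerSource
    have := weight_pos (-((p - 1) * (((N : ℝ) - 1) / 2))) (-(p - 1)) 0 t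
    positivity
  intro r t hr hrt htT
  obtain ⟨hi, hae⟩ := h.integrable_source hT₁ hT i χ
  have hpos : ∀ s ∈ Icc 0 T₁, (1 + s) ≠ 0 := fun s hs => by linarith [hs.1]
  have hc1 : ContinuousOn (fun s => μ / (1 + s) * expMean i χ ut s) (Icc 0 T₁) :=
    (continuousOn_const.div (by fun_prop) hpos).mul hD
  have hc2 : ContinuousOn (fun s => ν ^ 2 / (1 + s) ^ 2 * expMean i χ u s) (Icc 0 T₁) :=
    (continuousOn_const.div (by fun_prop) fun s hs => pow_ne_zero 2 (hpos s hs)).mul hU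
  have hii : ∀ {k : ℝ → ℝ}, ContinuousOn k (Icc 0 T₁) → ∀ {x y : ℝ}, 0 ≤ x → x ≤ y → y ≤ T₁ →
      IntervalIntegrable k volume x y := fun hk x y hx hxy hy => by
    apply ContinuousOn.intervalIntegrable
    rw [uIcc_of_le hxy]
    exact hk.mono (Icc_subset_Icc hx hy)
  have hiS : ∀ {x y : ℝ}, 0 ≤ x → x ≤ y → y ≤ T₁ →
      IntervalIntegrable (expSource i χ p ut) volume x y := fun hx hxy hy => by
    rw [intervalIntegrable_iff_integrableOn_Ioc_of_le hxy]
    exact hi.mono_set (Ioc_subset_Ioc hx hy)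
  have hr' : r ∈ Icc 0 T₁ := ⟨hr, hrt.trans htT⟩
  have ht' : t ∈ Icc 0 T₁ := ⟨hr.trans hrt, htT⟩
  -- The weak identity starts at time 0; the inequality on [r, t] is the difference of its instances
  -- at t and at r.
  have er := h.expMean_eq hsupp hT₁ hT i (χ := χ) (by linarith) hr'
  have et := h.expMean_eq hsupp hT₁ hT i (χ := χ) (by linarith) ht'
  have s1 := intervalIntegral.integral_interval_sub_left (hii hU le_rfl ht'.1 htT)
    (hii hU le_rfl hr hr'.2)
  have s2 := intervalIntegral.integral_interval_sub_left (hii hc1 le_rfl ht'.1 htT)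
    (hii hc1 le_rfl hr hr'.2)
  have s3 := intervalIntegral.integral_interval_sub_left (hii hc2 le_rfl ht'.1 htT)
    (hii hc2 le_rfl hr hr'.2)
  have s4 := intervalIntegral.integral_interval_sub_left (hiS le_rfl ht'.1 htT)
    (hiS le_rfl hr hr'.2)
  have hle : ∫ s in r..t,
      powerSource p (((N : ℝ) - 1) / 2) (coneConst N R ^ (-(p - 1))) (expMean i χ ut) s
      ≤ ∫ s in r..t, expSource i χ p ut s := by
    apply intervalIntegral.integral_mono_ae_restrict hrt (hii hS hr hrt htT) (hiS hr hrt htT)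
    have hss : Icc r t ⊆ Icc 0 T₁ := Icc_subset_Icc hr htT
    rw [restrict_Ioc_eq_restrict_Icc] at hae
    filter_upwards [ae_restrict_of_ae_restrict_of_subset hss hae,
      ae_restrict_mem measurableSet_Icc] with s hs hs1
    have hs2 := hss hs1
    exact powerSource_le_expSource hR hp i hs2.1 (by linarith [hs2.2])
      (hsupp.deriv (hsub hs2) (h.hasDerivWithinAt s (hsub hs2))) hs
  have hsplit : ∫ s in r..t, (-(μ / (1 + s)) * expMean i χ ut s
      + (1 - ν ^ 2 / (1 + s) ^ 2) * expMean i χ u s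
      + powerSource p (((N : ℝ) - 1) / 2) (coneConst N R ^ (-(p - 1))) (expMean i χ ut) s)
      = -(∫ s in r..t, μ / (1 + s) * expMean i χ ut s) + (∫ s in r..t, expMean i χ u s)
        - (∫ s in r..t, ν ^ 2 / (1 + s) ^ 2 * expMean i χ u s)
        + ∫ s in r..t,
          powerSource p (((N : ℝ) - 1) / 2) (coneConst N R ^ (-(p - 1))) (expMean i χ ut) s := by
    have j1 := hii hc1 hr hrt htT
    have j2 := hii hU hr hrt htT
    have j3 := hii hc2 hr hrt htT
    have j4 := hii hS hr hrt htT
    have j5 : IntervalIntegrable (fun s => expMean i χ u s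
        - ν ^ 2 / (1 + s) ^ 2 * expMean i χ u s) volume r t := j2.sub j3
    have j6 : IntervalIntegrable (fun s => expMean i χ u s
        - ν ^ 2 / (1 + s) ^ 2 * expMean i χ u s - μ / (1 + s) * expMean i χ ut s) volume r t :=
      j5.sub j1
    rw [neg_add_eq_sub, sub_right_comm, ← intervalIntegral.integral_sub j2 j3,
      ← intervalIntegral.integral_sub j5 j1, ← intervalIntegral.integral_add j6 j4]
    congr 1
    ext s
    ring
  rw [hsplit]
  linarith

end


/-! ### Initial data, transfer of the lifespan bound, and the critical exponent -/

theorem mul_planeExp_ae_eq {R : ℝ} {w : Space N → ℝ} (hw : ∀ᵐ x, R < ‖x‖ → w x = 0) (i : Fin N)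
    {χ : ContDiffBump (0 : Space N)} (hχ : R ≤ χ.rIn) :
    (fun x => w x * cutoffExp i χ x) =ᵐ[volume] fun x => w x * planeExp i x := by
  filter_upwards [hw] with x hx
  rcases le_or_gt ‖x‖ R with h | h
  · rw [cutoffExp_eq i χ (h.trans hχ)]
  · rw [hx h, zero_mul, zero_mul]

theorem integrable_mul_planeExp {R : ℝ} (hR : 0 < R) {w : Space N → ℝ} (hw2 : MemLp w 2 volume)
    (hw : ∀ᵐ x, R < ‖x‖ → w x = 0) (i : Fin N) : Integrable (fun x => w x * planeExp i x) := by
  let χ : ContDiffBump (0 : Space N) := ⟨R, R + 1, hR, by linarith⟩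
  exact (hw2.integrable_mul (memLp_cutoffExp i χ)).congr (mul_planeExp_ae_eq hw i (χ := χ) le_rfl)

theorem integral_mul_planeExp_pos {R : ℝ} (hR : 0 < R) {w : Space N → ℝ}
    (hw2 : MemLp w 2 volume) (hw : ∀ᵐ x, R < ‖x‖ → w x = 0) (hw0 : ∀ᵐ x, 0 ≤ w x)
    (hne : ¬ ∀ᵐ x, w x = 0) (i : Fin N) : 0 < ∫ x, w x * planeExp i x := by
  have hnn : 0 ≤ᵐ[volume] fun x => w x * planeExp i x := by
    filter_upwards [hw0] with x hx
    exact mul_nonneg hx (planeExp_pos i x).le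
  refine lt_of_le_of_ne (integral_nonneg_of_ae hnn) fun h0 => hne ?_
  have hz := (integral_eq_zero_iff_of_nonneg_ae hnn (integrable_mul_planeExp hR hw2 hw i)).1 h0.symm
  filter_upwards [hz] with x hx
  exact (mul_eq_zero.1 hx).resolve_right (planeExp_pos i x).ne'

theorem expMean_eq_of_ae_eq {R ε : ℝ} {w : Space N → ℝ} (hw : ∀ᵐ x, R < ‖x‖ → w x = 0)
    (i : Fin N) {χ : ContDiffBump (0 : Space N)} (hχ : R ≤ χ.rIn) {u : ℝ → L2 N} {t : ℝ}
    (hu : ∀ᵐ x, u t x = ε * w x) : expMean i χ u t = ε * ∫ x, w x * planeExp i x := by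
  rw [← integral_const_mul]
  apply integral_congr_ae
  filter_upwards [hu, mul_planeExp_ae_eq hw i hχ] with x hx hx2
  rw [hx, mul_assoc, hx2]

/-- A bound of the lifespan of supersolutions is a bound of the lifespan of energy solutions. -/
theorem lifespan_le_of_supersolution_bound {μ ν p R ε B : ℝ} {f g : Space N → ℝ}
    (hR : 0 < R) (hp : 1 < p) (hε : 0 < ε)
    (hf : MemLp f 2 volume) (hg : MemLp g 2 volume) (hf_nonneg : ∀ᵐ x, 0 ≤ f x)
    (hf_supp : ∀ᵐ x, R < ‖x‖ → f x = 0) (hg_supp : ∀ᵐ x, R < ‖x‖ → g x = 0) (i : Fin N)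
    (hB : ∀ (T : ℝ) (U D : ℝ → ℝ), IsSupersolution μ ν T
      (powerSource p (((N : ℝ) - 1) / 2) (coneConst N R ^ (-(p - 1))) D) U D → 0 ≤ U 0 →
      ε * (∫ x, ((μ - 1 - √(delta μ ν)) / 2 * f x + g x) * planeExp i x)
        ≤ D 0 + (μ - 1 - √(delta μ ν)) / 2 * U 0 → T ≤ B)
    {T : ℝ≥0∞} {u : ℝ → L2 N} (h : IsEnergySolution μ ν p ε f g T u)
    (hsupp : SupportedInCone R T u) : T ≤ ENNReal.ofReal B := by
  obtain ⟨ut, Du, v, h⟩ := h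
  refine ENNReal.le_of_forall_nnreal_lt fun T₁ hT₁ => ?_
  rw [← ENNReal.ofReal_coe_nnreal] at hT₁ ⊢
  apply ENNReal.ofReal_le_ofReal
  have hT0 : (0 : ℝ) ≤ T₁ := T₁.2
  -- The cut-off depends on T₁, but the initial values of U and D do not: f and g live in the ball
  -- of radius R, where χ = 1. The bound B is therefore uniform in T₁.
  let χ : ContDiffBump (0 : Space N) :=
    ⟨T₁ + (R + 1), T₁ + (R + 1) + 1, by positivity, by linarith⟩
  have hχ : R ≤ χ.rIn := show R ≤ T₁ + (R + 1) by linarith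
  have hU := expMean_eq_of_ae_eq hf_supp i hχ h.initial
  have hD := expMean_eq_of_ae_eq hg_supp i hχ h.initial_deriv
  refine hB T₁ (expMean i χ u) (expMean i χ ut)
    (h.isSupersolution hsupp hR hp hT0 hT₁ i (χ := χ) le_rfl) ?_ (le_of_eq ?_)
  · rw [hU]
    refine mul_nonneg hε.le (integral_nonneg_of_ae ?_)
    filter_upwards [hf_nonneg] with x hx
    exact mul_nonneg hx (planeExp_pos i x).le
  · rw [hU, hD]
    have e : ∫ x, ((μ - 1 - √(delta μ ν)) / 2 * f x + g x) * planeExp i x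
        = (μ - 1 - √(delta μ ν)) / 2 * (∫ x, f x * planeExp i x)
          + ∫ x, g x * planeExp i x := by
      rw [← integral_const_mul, ← integral_add
        ((integrable_mul_planeExp hR hf hf_supp i).const_mul _)
        (integrable_mul_planeExp hR hg hg_supp i)]
      congr 1
      ext x
      ring
    rw [e]
    ring

/-- For n = 1 the right side reads 0 < 1, in accordance with p_G(1) = +∞. -/
theorem lt_glasseyExponent_iff {n p : ℝ} (hn : 1 ≤ n) :
    (p : EReal) < glasseyExponent n ↔ (n - 1) / 2 * (p - 1) < 1 := by
  unfold glasseyExponent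
  split_ifs with h
  · have : n = 1 := le_antisymm h hn
    simp [this]
  · have h1 : 0 < n - 1 := by linarith [not_le.1 h]
    rw [EReal.coe_lt_coe_iff, ← sub_lt_iff_lt_add', lt_div_iff₀ h1]
    constructor <;> intro h2 <;> linarith

theorem eq_glasseyExponent {n p : ℝ} (h : (p : EReal) = glasseyExponent n) :
    (n - 1) / 2 * (p - 1) = 1 := by
  unfold glasseyExponent at h
  split_ifs at h with h'
  · exact absurd h (EReal.coe_ne_top p)
  · have h1 : 0 < n - 1 := by linarith [not_le.1 h']
    rw [EReal.coe_eq_coe_iff] at h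
    rw [h]
    field_simp
    ring

end DampedWave

open DampedWave
theorem theorem2p2 (N : ℕ) (hN : 1 ≤ N) (μ ν p R : ℝ) (hμ : 0 ≤ μ) (hδ : 0 ≤ delta μ ν)
    (hp : 1 < p) (hR : 0 < R) (f g : Space N → ℝ)
    (hf : MemH1 f) (hg : MemLp g 2 volume)
    (hf_nonneg : ∀ᵐ x, 0 ≤ f x) (hg_nonneg : ∀ᵐ x, 0 ≤ g x)
    (hf_supp : ∀ᵐ x, R < ‖x‖ → f x = 0) (hg_supp : ∀ᵐ x, R < ‖x‖ → g x = 0)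
    (hfg : ∀ᵐ x, 0 ≤ (μ - 1 - √(delta μ ν)) / 2 * f x + g x)
    (hfg_ne : ¬ ∀ᵐ x, (μ - 1 - √(delta μ ν)) / 2 * f x + g x = 0) :
    ∃ ε₀ : ℝ, 0 < ε₀ ∧ ∃ C : ℝ, 0 < C ∧
      ∀ ε : ℝ, 0 < ε → ε ≤ ε₀ → ∀ (T : ℝ≥0∞) (u : ℝ → L2 N),
        IsEnergySolution μ ν p ε f g T u → SupportedInCone R T u →
          ((p : EReal) < glasseyExponent (N + μ) →
            T ≤ ENNReal.ofReal
              (C * ε ^ (-(2 * (p - 1) / (2 - (N + μ - 1) * (p - 1)))))) ∧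
          ((p : EReal) = glasseyExponent (N + μ) →
            T ≤ ENNReal.ofReal (Real.exp (C * ε ^ (-(p - 1))))) := by
  set i : Fin N := ⟨0, hN⟩
  set b := (μ - 1 - √(delta μ ν)) / 2 with hb
  have hw2 : MemLp (fun x => b * f x + g x) 2 volume := (hf.1.const_mul b).add hg
  have hw : ∀ᵐ x, R < ‖x‖ → b * f x + g x = 0 := by
    filter_upwards [hf_supp, hg_supp] with x h1 h2 hx
    rw [h1 hx, h2 hx, mul_zero, add_zero]
  have hA₀ := integral_mul_planeExp_pos hR hw2 hw hfg hfg_ne i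
  have hc₀ : 0 < coneConst N R ^ (-(p - 1)) := Real.rpow_pos_of_pos (coneConst_pos N hR) _
  have hN1 : (1 : ℝ) ≤ N := by exact_mod_cast hN
  have hθ : (((N : ℝ) - 1) / 2 + μ / 2) * (p - 1) = (N + μ - 1) / 2 * (p - 1) := by ring
  rcases lt_trichotomy ((N + μ - 1) / 2 * (p - 1)) 1 with hlt | heq | hgt
  · obtain ⟨C, hC, key⟩ := lifespan_of_powerSource_subcritical μ ν p (((N : ℝ) - 1) / 2) _ _
      hμ hδ hp hc₀ hA₀ (hθ.trans_lt hlt)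
    refine ⟨1, one_pos, C, hC, fun ε hε hε1 T u h hsupp => ⟨fun _ => ?_, fun hcr => ?_⟩⟩
    · refine lifespan_le_of_supersolution_bound hR hp hε hf.1 hg hf_nonneg hf_supp hg_supp i
        (fun T U D hs hU hV => ?_) h hsupp
      have := key ε hε hε1 T U D hs hU hV
      rw [hθ] at this
      convert this using 3
      have h1 : 1 - (N + μ - 1) / 2 * (p - 1) ≠ 0 := by linarith
      have h2 : 2 - (N + μ - 1) * (p - 1) ≠ 0 := by
        intro h0
        apply h1
        linarith
      rw [neg_inj, div_eq_div_iff h2 h1]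
      ring
    · exact absurd (eq_glasseyExponent hcr) hlt.ne
  · obtain ⟨C, hC, key⟩ := lifespan_of_powerSource_critical μ ν p (((N : ℝ) - 1) / 2) _ _
      hμ hδ hp hc₀ hA₀ (hθ.trans heq)
    refine ⟨1, one_pos, C, hC, fun ε hε hε1 T u h hsupp => ⟨fun hsub => ?_, fun _ => ?_⟩⟩
    · exact absurd heq ((lt_glasseyExponent_iff (by linarith)).1 hsub).ne
    · exact lifespan_le_of_supersolution_bound hR hp hε hf.1 hg hf_nonneg hf_supp hg_supp i
        (fun T U D hs hU hV => key ε hε hε1 T U D hs hU hV) h hsupp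
  -- Above the critical exponent both assertions are vacuous, and any constants serve.
  · exact ⟨1, one_pos, 1, one_pos, fun ε _ _ T u _ _ =>
      ⟨fun hsub => absurd ((lt_glasseyExponent_iff (by linarith)).1 hsub) hgt.not_gt,
        fun hcr => absurd (eq_glasseyExponent hcr) hgt.ne'⟩⟩
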